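/- Let $k$ be a field, $R=k[x,y]$ with the standard grading and the lexicographic order with $x>y$, and let $E\subseteq R$ be a monomial ideal with $\dim_k R/E<\infty$. Let $V(E)$ be the set of homogeneous ideals $I$ of $R$ whose leading-term ideal $\operatorname{Lt}(I)$ is $E$. For a homogeneous ideal $I$ let $\beta_{0,j}(I)=\dim_k (I/(x,y)I)_j$ be the number of minimal generators of $I$ of degree $j$, and for integers $j,u$ put $V(E,j,\ge u)=\{I\in V(E):\beta_{0,j}(I)\ge u\}$. Put $t=\min\{j: x^j\in E\}$, $m_i=\min\{j: x^{t-i}y^j\in E\}$ for $0\le i\le t$, $d_i=m_i-m_{i-1}$ for $1\le i\le t$, and $u_{ij}=m_j-m_{i-1}+i-j$ for $1\le i\le t+1$, $1\le j\le t$. Let $\mathcal S(E)=\{(i,j): 1\le j<i\le t+1,\ 0\le u_{ij}<d_j\}$. For $p=(p_{ij})\in k^{\mathcal S(E)}$ let $M(p)$ be the $(t+1)\times t$ matrix over $R$ obtained from the matrix with entries $y^{d_i}$ at $(i,i)$, $-x$ at $(i+1,i)$ and $0$ elsewhere by adding $p_{ij}y^{u_{ij}}$ to the $(i,j)$-th entry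 for every $(i,j)\in\mathcal S(E)$, and let $I(p)$ be the ideal generated by the $t\times t$ minors of $M(p)$. Put $a_i=t+1-i+m_{i-1}$ for $1\le i\le t+1$, $b_i=a_{i+1}+1$ for $1\le i\le t$, $w_j=\{i:a_i=j\}$ and $v_j=\{i:b_i=j\}$. Let $M(p)_j$ be the submatrix of $M(p)$ with row indices $w_j$ and column indices $v_j$; its entries are constants, and the $(i,i)$-th entry is $1$ for every $i\in w_j\cap v_j$. Let $M(p)_j^*$ be obtained from $M(p)_j$ by deleting the rows and columns with index in $w_j\cap v_j$. **Lemma.** The map $p\mapsto I(p)$ is a bijection from the affine space $k^{\mathcal S(E)}$ onto $V(E)$, and in the coordinates $p$ that it provides, for all integers $j,u$, the subset $V(E,j,\ge u)$ is defined by the rank condition $$\operatorname{rank} M(p)_j^*\le \beta_{0,j}(E)-u,$$ that is, $I(p)\in V(E,j,\ge u)$ if and only if $\operatorname{rank} M(p)_j^*\le \beta_{0,j}(E)-u$. -/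

import Mathlib

open MvPolynomial

noncomputable section

namespace HilbertBurch

attribute [local instance] MvPolynomial.gradedAlgebra

/-! ### Polynomials in two variables, initial ideals, Betti numbers -/

/-- The polynomial ring `k[x, y]`; the variable `x` is `X 0` and `y` is `X 1`. -/
abbrev Poly (k : Type*) [Field k] := MvPolynomial (Fin 2) k

/-- The ideal generated by the leading terms of the nonzero elements of `I`, for the
lexicographic order with `x > y` (in `MonomialOrder.lex` on `Fin 2` one has `X 1 < X 0`). -/
def leadIdeal {k : Type*} [Field k] (I : Ideal (Poly k)) : Ideal (Poly k) :=
  Ideal.span {g | ∃ f ∈ I, f ≠ 0 ∧ g = monomial ((MonomialOrder.lex (σ := Fin 2)).degree f) (1 : k)}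

/-- An ideal of `k[x, y]` generated by monomials. -/
def IsMonomialIdeal {k : Type*} [Field k] (E : Ideal (Poly k)) : Prop :=
  ∃ S : Set (Fin 2 →₀ ℕ), E = Ideal.span ((fun e => monomial e (1 : k)) '' S)

/-- The Gröbner cell `V(E)`: homogeneous ideals (standard grading) with initial ideal `E`. -/
def cell {k : Type*} [Field k] (E : Ideal (Poly k)) : Set (Ideal (Poly k)) :=
  {I | I.IsHomogeneous (homogeneousSubmodule (Fin 2) k) ∧ leadIdeal I = E}

/-- The `k`-space of homogeneous polynomials of degree `j` (zero for `j < 0`). -/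
def degreePart (k : Type*) [Field k] (j : ℤ) : Submodule k (Poly k) :=
  restrictSupport k {e | ((e.degree : ℕ) : ℤ) = j}

/-- The degree-`j` part `I ∩ R_j` of an ideal `I` of `R = k[x, y]`. -/
def idealPart {k : Type*} [Field k] (I : Ideal (Poly k)) (j : ℤ) : Submodule k (Poly k) :=
  I.restrictScalars k ⊓ degreePart k j

/-- The graded Betti number `β_{0,j}(I) = dim_k (I / (x, y) I)_j` of a homogeneous ideal `I`,
that is, the number of elements of degree `j` in a minimal homogeneous generating set. -/
def beta0 {k : Type*} [Field k] (I : Ideal (Poly k)) (j : ℤ) : ℕ :=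
  Module.finrank k
    (idealPart I j ⧸ (idealPart (Ideal.span {X 0, X 1} * I) j).submoduleOf (idealPart I j))

/-- The stratum `V(E, j, ≥ u)`. -/
def stratum {k : Type*} [Field k] (E : Ideal (Poly k)) (j u : ℤ) : Set (Ideal (Poly k)) :=
  {I | I ∈ cell E ∧ u ≤ (beta0 I j : ℤ)}

/-! ### The numerical data of a monomial ideal -/

/-- `t = min {j : x ^ j ∈ E}`. -/
def tOf {k : Type*} [Field k] (E : Ideal (Poly k)) : ℕ :=
  sInf {j | (X 0 : Poly k) ^ j ∈ E}

/-- `m_i = min {j : x ^ (t - i) y ^ j ∈ E}`, used for `0 ≤ i ≤ t`. -/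
def mOf {k : Type*} [Field k] (E : Ideal (Poly k)) (i : ℕ) : ℕ :=
  sInf {j | (X 0 : Poly k) ^ (tOf E - i) * X 1 ^ j ∈ E}

/-! ### The canonical matrices

Everything below depends only on `t` and a nondecreasing sequence `0 = m 0 < m 1 ≤ … ≤ m t`.
Rows and columns of `(t + 1) × t` matrices are numbered from `0`; so row `r` and column `c` are
the row `r + 1` and the column `c + 1` of the usual numbering, and the `(i, i)` entries are those
with `r = c.castSucc`. -/

/-- The exponent `d_{c+1} = m_{c+1} - m_c`. -/
def dExp {t : ℕ} (m : ℕ → ℕ) (c : Fin t) : ℕ := m (c + 1) - m c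

/-- Degree of the generator belonging to row `r`: `a_i = t + 1 - i + m_{i-1}` with `i = r + 1`. -/
def rowDeg {t : ℕ} (m : ℕ → ℕ) (r : Fin (t + 1)) : ℤ := (t : ℤ) - (r : ℕ) + m r

/-- Degree of the syzygy belonging to column `c`: `b_i = a_{i+1} + 1` with `i = c + 1`. -/
def colDeg {t : ℕ} (m : ℕ → ℕ) (c : Fin t) : ℤ := rowDeg m c.succ + 1

/-- The degree matrix `u_{ij} = m_j - m_{i-1} + i - j` with `i = r + 1`, `j = c + 1`. -/
def uDeg {t : ℕ} (m : ℕ → ℕ) (r : Fin (t + 1)) (c : Fin t) : ℤ :=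
  (m (c + 1) : ℤ) - m r + (r : ℕ) - (c : ℕ)

/-- The index set `{(i, j) : j < i, 0 ≤ u_{ij} < d_j}` of the coordinates. -/
def paramSet (t : ℕ) (m : ℕ → ℕ) : Set (Fin (t + 1) × Fin t) :=
  {q | (q.2 : ℕ) < (q.1 : ℕ) ∧ 0 ≤ uDeg m q.1 q.2 ∧ uDeg m q.1 q.2 < dExp m q.2}

/-- The monomial Hilbert–Burch matrix: `y ^ d_i` at `(i, i)`, `-x` at `(i + 1, i)`, and `0`
elsewhere. -/
def baseMatrix (k : Type*) [Field k] (t : ℕ) (m : ℕ → ℕ) :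
    Matrix (Fin (t + 1)) (Fin t) (Poly k) :=
  Matrix.of fun r c =>
    if r = c.castSucc then X 1 ^ dExp m c else if r = c.succ then -X 0 else 0

open Classical in
/-- The matrix `N` with entry `p_{ij} y ^ u_{ij}` at `(i, j)` in the index set and `0`
elsewhere. -/
def paramMatrix {k : Type*} [Field k] (t : ℕ) (m : ℕ → ℕ) (p : paramSet t m → k) :
    Matrix (Fin (t + 1)) (Fin t) (Poly k) :=
  Matrix.of fun r c =>
    if h : (r, c) ∈ paramSet t m then C (p ⟨(r, c), h⟩) * X 1 ^ (uDeg m r c).toNat else 0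

/-- The canonical Hilbert–Burch matrix `M(p)`. -/
def canonMatrix {k : Type*} [Field k] (t : ℕ) (m : ℕ → ℕ) (p : paramSet t m → k) :
    Matrix (Fin (t + 1)) (Fin t) (Poly k) :=
  baseMatrix k t m + paramMatrix t m p

/-- The ideal of maximal minors of a `(t + 1) × t` matrix: the minors obtained by deleting one
row. -/
def maxMinors {k : Type*} [Field k] {t : ℕ} (M : Matrix (Fin (t + 1)) (Fin t) (Poly k)) :
    Ideal (Poly k) :=
  Ideal.span (Set.range fun r : Fin (t + 1) => (M.submatrix r.succAbove id).det)

/-- `w_j = {i : a_i = j}`. -/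
def rowsOf (t : ℕ) (m : ℕ → ℕ) (j : ℤ) : Finset (Fin (t + 1)) :=
  Finset.univ.filter fun r => rowDeg m r = j

/-- `v_j = {i : b_i = j}`. -/
def colsOf (t : ℕ) (m : ℕ → ℕ) (j : ℤ) : Finset (Fin t) :=
  Finset.univ.filter fun c => colDeg m c = j

/-- The submatrix `M(p)_j` with rows `w_j` and columns `v_j`. It describes the degree-`j` part of
`M(p) ⊗ k`; its entries are homogeneous of degree `0`, and are read in `k`. -/
def blockMatrix {k : Type*} [Field k] (t : ℕ) (m : ℕ → ℕ) (p : paramSet t m → k) (j : ℤ) :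
    Matrix (rowsOf t m j) (colsOf t m j) k :=
  Matrix.of fun r c => constantCoeff (canonMatrix t m p r.1 c.1)

/-- The matrix `M(p)_j^*`: the unit entries of `M(p)_j` are its `(i, i)` entries with
`i ∈ w_j ∩ v_j`; the rows and columns that contain them are removed. -/
def blockMatrixStar {k : Type*} [Field k] (t : ℕ) (m : ℕ → ℕ) (p : paramSet t m → k) (j : ℤ) :
    Matrix {r : rowsOf t m j // ∀ c ∈ colsOf t m j, c.castSucc ≠ r.1}
      {c : colsOf t m j // c.1.castSucc ∉ rowsOf t m j} k :=
  (blockMatrix t m p j).submatrix Subtype.val Subtype.val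

/-- The entries of `M(p)_j` are constants, so nothing is lost by reading them in `k`. -/
theorem C_blockMatrix {k : Type*} [Field k] (t : ℕ) (m : ℕ → ℕ) (p : paramSet t m → k) (j : ℤ)
    (r : rowsOf t m j) (c : colsOf t m j) (hm : m c.1 ≤ m (c.1 + 1)) :
    C (blockMatrix t m p j r c) = canonMatrix t m p r.1 c.1 := by
  obtain ⟨r, hr⟩ := r
  obtain ⟨c, hc⟩ := c
  simp only [rowsOf, colsOf, Finset.mem_filter, Finset.mem_univ, true_and] at hr hc
  have hu : uDeg m r c = 0 := by
    simp only [rowDeg, colDeg, uDeg, Fin.val_succ] at *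
    push_cast at *
    linarith
  have h1 : r = c.castSucc → dExp m c = 0 := by
    rintro rfl
    simp only [uDeg, dExp, Fin.val_castSucc] at *
    omega
  have h2 : r ≠ c.succ := by
    rintro rfl
    simp [uDeg] at hu
  simp only [blockMatrix, canonMatrix, baseMatrix, paramMatrix, Matrix.of_apply, Matrix.add_apply,
    hu, h2, if_false]
  by_cases h : r = c.castSucc
  · rw [if_pos h, h1 h]
    split_ifs <;> simp
  · rw [if_neg h]
    split_ifs <;> simp

/-- The ideal with coordinates `p`: the ideal of maximal minors of `M(p)`. -/
def cellMap {k : Type*} [Field k] (E : Ideal (Poly k)) (p : paramSet (tOf E) (mOf E) → k) :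
    Ideal (Poly k) :=
  maxMinors (canonMatrix (tOf E) (mOf E) p)

end HilbertBurch

end

open MvPolynomial

noncomputable section

namespace HilbertBurch

attribute [local instance] MvPolynomial.gradedAlgebra

/-! ### Leading monomials in two variables -/

section LeadingMonomials

/-! Number rows and columns from 0 and write d_c for `dExp m c`. Let F_0, …, F_t be the signed
maximal minors of M(p). Then F_t = y^{m_t}, and column c is the relation y^{d_c} F_c = x F_{c+1} -
Σ_{r>c} p_{rc} y^{u_{rc}} F_r. As y^{d_c} is a nonzerodivisor, these relations determine the F_r
from the bottom row upwards; such a sequence is a chain (`IsChain`). The parameter terms have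
smaller degree in x, so F_r is homogeneous with leading term x^{t-r} y^{m_r}.

The entries -x below the diagonal allow every vector of coefficients to be reduced, modulo the
columns, to one whose entries outside row 0 lie in k[y] (`exists_normalVec`). In Σ g_r F_r with such
coefficients the leading monomials have distinct x-exponents and cannot cancel
(`exists_le_degree_of_normalVec`). Hence the F_r form a Gröbner basis of an ideal with initial ideal
E, and the columns generate all syzygies, which is the Hilbert–Burch theorem in this case.

Injectivity: if two chains in one ideal agree below row c, a difference of parameters in column c
would make F_c - G_c an element of the ideal with leading monomial x^{t-s} y^e, e < m_s, because
u_{sc} < d_c (`IsChain.column_eq`). Surjectivity: a chain is built inside a given I of the cell; the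
relation sought for row c is corrected by absorbing all multiples of y^{d_c} into the new generator,
and what remains is exactly of the form allowed by the parameters (`exists_columnRel`). The chain
spans an ideal contained in I with the same initial ideal, hence I.

Betti numbers: (I/(x,y)I)_j is spanned by the F_r of degree j, modulo the constant terms of the
syzygies. Rows with a unit entry give F_c = x F_{c+1} and drop out, so β_{0,j}(I(p)) is the number
of rows of M(p)_j^* minus its rank (`IsChain.beta0_add_rank`). At p = 0 the ideal is E and the block
is zero, so that number of rows is β_{0,j}(E). -/

/-- The lexicographic order on the monomials of `k[x, y]`, with `x > y`. -/
abbrev lexOrd : MonomialOrder (Fin 2) := MonomialOrder.lex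

/-- The exponent vector of `x ^ a * y ^ b`. -/
def mon (a b : ℕ) : Fin 2 →₀ ℕ := Finsupp.single 0 a + Finsupp.single 1 b

@[simp] lemma mon_apply_zero (a b : ℕ) : mon a b 0 = a := by simp [mon]

@[simp] lemma mon_apply_one (a b : ℕ) : mon a b 1 = b := by simp [mon]

lemma exponent_ext {d e : Fin 2 →₀ ℕ} (h0 : d 0 = e 0) (h1 : d 1 = e 1) : d = e := by
  ext i; fin_cases i <;> assumption

lemma eq_mon (e : Fin 2 →₀ ℕ) : e = mon (e 0) (e 1) := exponent_ext (by simp) (by simp)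

lemma mon_add (a b c d : ℕ) : mon a b + mon c d = mon (a + c) (b + d) :=
  exponent_ext (by simp) (by simp)

lemma exponent_degree (e : Fin 2 →₀ ℕ) : e.degree = e 0 + e 1 := by
  simp [Finsupp.degree_eq_sum]

lemma exponent_le {d e : Fin 2 →₀ ℕ} : d ≤ e ↔ d 0 ≤ e 0 ∧ d 1 ≤ e 1 := by
  rw [Finsupp.le_def, Fin.forall_fin_two]

lemma lex_lt_of_fst_lt {d e : Fin 2 →₀ ℕ} (h : d 0 < e 0) :
    lexOrd.toSyn d < lexOrd.toSyn e := by
  rw [MonomialOrder.lex_lt_iff, Finsupp.Lex.lt_iff]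
  exact ⟨0, by simp, h⟩

lemma fst_le_of_lex_le {d e : Fin 2 →₀ ℕ} (h : lexOrd.toSyn d ≤ lexOrd.toSyn e) :
    d 0 ≤ e 0 := by
  by_contra hlt
  exact absurd (lex_lt_of_fst_lt (not_le.mp hlt)) (not_lt.mpr h)

variable {k : Type*} [Field k]

lemma monomial_mon (a b : ℕ) : monomial (mon a b) (1 : k) = X 0 ^ a * X 1 ^ b := by
  rw [mon, ← one_mul (1 : k), ← monomial_mul, X_pow_eq_monomial, X_pow_eq_monomial]

/-- `f` has leading term `x ^ s * y ^ e`. -/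
def IsLead (f : Poly k) (s e : ℕ) : Prop :=
  lexOrd.degree f = mon s e ∧ lexOrd.leadingCoeff f = 1

lemma IsLead.ne_zero {f : Poly k} {s e : ℕ} (h : IsLead f s e) : f ≠ 0 := by
  rintro rfl
  simpa using h.2

lemma IsLead.mul {f g : Poly k} {s e s' e' : ℕ} (hf : IsLead f s e) (hg : IsLead g s' e') :
    IsLead (f * g) (s + s') (e + e') := by
  refine ⟨?_, MonomialOrder.Monic.mul hf.2 hg.2⟩
  rw [MonomialOrder.degree_mul hf.ne_zero hg.ne_zero, hf.1, hg.1, mon_add]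

lemma isLead_monomial (s e : ℕ) : IsLead (monomial (mon s e) (1 : k)) s e := by
  classical
  exact ⟨by simp [MonomialOrder.degree_monomial], by simp⟩

lemma isLead_X_zero_pow (s : ℕ) : IsLead (X 0 ^ s : Poly k) s 0 := by
  simpa [monomial_mon] using isLead_monomial (k := k) s 0

lemma isLead_X_zero : IsLead (X 0 : Poly k) 1 0 := by
  simpa using isLead_X_zero_pow (k := k) 1

lemma isLead_X_one_pow (e : ℕ) : IsLead (X 1 ^ e : Poly k) 0 e := by
  simpa [monomial_mon] using isLead_monomial (k := k) 0 e

/-- Divides a column relation by its power of y. -/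
lemma IsLead.of_X_one_pow_mul {f : Poly k} {n s e : ℕ} (h : IsLead (X 1 ^ n * f) s (n + e)) :
    IsLead f s e := by
  have hf : f ≠ 0 := fun hf => h.ne_zero (by simp [hf])
  have hX := isLead_X_one_pow (k := k) n
  constructor
  · have := h.1
    rw [MonomialOrder.degree_mul hX.ne_zero hf, hX.1] at this
    refine exponent_ext ?_ ?_
    · simpa using DFunLike.congr_fun this 0
    · simpa using DFunLike.congr_fun this 1
  · have := h.2
    rwa [MonomialOrder.leadingCoeff_mul_of_left_mem_nonZeroDivisors (by simp [hX.2]), hX.2,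
      one_mul] at this

variable (k) in
/-- The polynomials of degree less than `s` in `x`. -/
def xLT (s : ℕ) : Submodule k (Poly k) := restrictSupport k {e | e 0 < s}

lemma mem_xLT {s : ℕ} {f : Poly k} : f ∈ xLT k s ↔ ∀ e ∈ f.support, e 0 < s := by
  rw [xLT, mem_restrictSupport_iff]; rfl

lemma mem_xLT_iff_degree {s : ℕ} {f : Poly k} :
    f ∈ xLT k s ↔ f = 0 ∨ lexOrd.degree f 0 < s := by
  rw [mem_xLT]
  constructor
  · intro h
    by_cases hf : f = 0
    · exact Or.inl hf
    · exact Or.inr (h _ (MonomialOrder.degree_mem_support hf))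
  · rintro (rfl | h) e he
    · simp at he
    · exact (fst_le_of_lex_le (lexOrd.le_degree he)).trans_lt h

lemma IsLead.mem_xLT {f : Poly k} {s e n : ℕ} (h : IsLead f s e) (hn : s < n) : f ∈ xLT k n := by
  rw [mem_xLT_iff_degree, h.1]
  simp [hn]

/-- With x > y, a smaller degree in x already makes a term lexicographically smaller, so no
y-exponents need be compared. -/
lemma IsLead.add {f g : Poly k} {s e : ℕ} (hf : IsLead f s e) (hg : g ∈ xLT k s) :
    IsLead (f + g) s e := by
  rcases mem_xLT_iff_degree.mp hg with rfl | hg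
  · simpa
  · have : lexOrd.toSyn (lexOrd.degree g) < lexOrd.toSyn (lexOrd.degree f) :=
      lex_lt_of_fst_lt (by rw [hf.1]; simpa using hg)
    exact ⟨by rw [MonomialOrder.degree_add_of_lt this, hf.1],
      by rw [MonomialOrder.leadingCoeff_add_of_lt this, hf.2]⟩

lemma IsLead.sub {f g : Poly k} {s e : ℕ} (hf : IsLead f s e) (hg : g ∈ xLT k s) :
    IsLead (f - g) s e := by
  rw [sub_eq_add_neg]
  exact hf.add (neg_mem hg)

lemma IsLead.smul_mem_xLT {f : Poly k} {s e n : ℕ} (h : IsLead f s e) (hn : s < n) (a : k)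
    (l : ℕ) : C a * X 1 ^ l * f ∈ xLT k n := by
  rw [mul_assoc, ← smul_eq_C_mul]
  exact Submodule.smul_mem _ _
    (((isLead_X_one_pow l).mul h).mem_xLT (n := n) (by simpa using hn))

lemma isHomogeneous_iff {f : Poly k} {d : ℕ} :
    f.IsHomogeneous d ↔ ∀ e, coeff e f ≠ 0 → e 0 + e 1 = d := by
  constructor
  · intro h e he
    rw [← exponent_degree]
    by_contra hne
    exact he (h.coeff_eq_zero hne)
  · intro h e he
    rw [← h e he, ← exponent_degree, Finsupp.degree_eq_weight_one]
    rfl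

lemma degree_of_isHomogeneous {f : Poly k} {d : ℕ} (hf : f.IsHomogeneous d) (h0 : f ≠ 0) :
    lexOrd.degree f 0 + lexOrd.degree f 1 = d := by
  exact isHomogeneous_iff.mp hf _ (MonomialOrder.coeff_degree_ne_zero_iff.mpr h0)

/-- The difference of homogeneous polynomials of the same degree and with the same leading term
has smaller degree in `x`. -/
lemma sub_mem_xLT {f g : Poly k} {d s : ℕ} (hf : f.IsHomogeneous d) (hg : g.IsHomogeneous d)
    (hfs : f ∈ xLT k (s + 1)) (hgs : g ∈ xLT k (s + 1))
    (h : coeff (mon s (d - s)) f = coeff (mon s (d - s)) g) : f - g ∈ xLT k s := by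
  rw [mem_xLT]
  intro e he
  have hle : e 0 < s + 1 := mem_xLT.mp (sub_mem hfs hgs) e he
  refine lt_of_le_of_ne (Nat.lt_succ_iff.mp hle) fun hes => ?_
  have hd := isHomogeneous_iff.mp (hf.sub hg) e (mem_support_iff.mp he)
  have : e = mon s (d - s) := exponent_ext (by simpa using hes) (by simp; omega)
  rw [mem_support_iff, this, coeff_sub, h, sub_self] at he
  exact he rfl

lemma IsLead.coeff {f : Poly k} {s e : ℕ} (h : IsLead f s e) : coeff (mon s e) f = 1 := by
  rw [← h.1]; exact h.2

lemma IsHomogeneous.of_X_one_pow_mul {f : Poly k} {n d : ℕ}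
    (h : (X 1 ^ n * f).IsHomogeneous (n + d)) : f.IsHomogeneous d := by
  rw [isHomogeneous_iff] at h ⊢
  intro e he
  have := h (mon 0 n + e) (by
    have h1 : (X 1 ^ n : Poly k) = monomial (mon 0 n) 1 := by simp [monomial_mon]
    rwa [h1, coeff_monomial_mul, one_mul])
  simp only [Finsupp.add_apply, mon_apply_zero, mon_apply_one] at this
  omega

/-- A sum of nonzero polynomials with distinct leading monomials is nonzero, and its leading
monomial is one of theirs. -/
lemma exists_degree_sum_eq {ι : Type*} (s : Finset ι) (hs : s.Nonempty) (f : ι → Poly k)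
    (h0 : ∀ i ∈ s, f i ≠ 0)
    (hinj : ∀ i ∈ s, ∀ j ∈ s, lexOrd.degree (f i) = lexOrd.degree (f j) → i = j) :
    (∑ i ∈ s, f i) ≠ 0 ∧ ∃ i ∈ s, lexOrd.degree (∑ i ∈ s, f i) = lexOrd.degree (f i) := by
  classical
  obtain ⟨i, hi, hmax⟩ := s.exists_max_image (fun i => lexOrd.toSyn (lexOrd.degree (f i))) hs
  rw [← Finset.add_sum_erase s f hi]
  by_cases hz : ∑ j ∈ s.erase i, f j = 0
  · exact ⟨by simpa [hz] using h0 i hi, i, hi, by simp [hz]⟩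
  -- By injectivity the maximal leading monomial is attained only at `i`, so the remaining terms sum
  -- to something strictly smaller.
  have hlt : lexOrd.toSyn (lexOrd.degree (∑ j ∈ s.erase i, f j)) <
      lexOrd.toSyn (lexOrd.degree (f i)) := by
    have hne : (s.erase i).Nonempty := by
      rw [Finset.nonempty_iff_ne_empty]
      intro h
      simp [h] at hz
    obtain ⟨j, hj, hj'⟩ := Finset.exists_mem_eq_sup (s.erase i) hne
      (fun x => lexOrd.toSyn (lexOrd.degree (f x)))
    refine lt_of_le_of_lt lexOrd.degree_sum_le ?_
    rw [hj']
    refine lt_of_le_of_ne (hmax j (Finset.mem_of_mem_erase hj)) fun h => ?_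
    exact Finset.ne_of_mem_erase hj
      (hinj _ (Finset.mem_of_mem_erase hj) _ hi (lexOrd.toSyn.injective h))
  have hd := lexOrd.degree_add_of_lt hlt
  refine ⟨fun h => ?_, i, hi, hd⟩
  have := lexOrd.leadingCoeff_add_of_lt hlt
  rw [h, MonomialOrder.leadingCoeff_zero] at this
  exact h0 i hi (lexOrd.leadingCoeff_eq_zero_iff.mp this.symm)

end LeadingMonomials

/-! ### Minors of the canonical matrix -/

section Chain

variable {k : Type*} [Field k] {t : ℕ} {m : ℕ → ℕ}

lemma paramMatrix_of_mem {p : paramSet t m → k} {r : Fin (t + 1)} {c : Fin t}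
    (h : (r, c) ∈ paramSet t m) :
    paramMatrix t m p r c = C (p ⟨(r, c), h⟩) * X 1 ^ (uDeg m r c).toNat := by
  simp [paramMatrix, h]

lemma paramMatrix_of_notMem {p : paramSet t m → k} {r : Fin (t + 1)} {c : Fin t}
    (h : (r, c) ∉ paramSet t m) : paramMatrix t m p r c = 0 := by
  simp [paramMatrix, h]

lemma sum_baseMatrix_mul (F : Fin (t + 1) → Poly k) (c : Fin t) :
    ∑ r, baseMatrix k t m r c * F r = X 1 ^ dExp m c * F c.castSucc - X 0 * F c.succ := by
  have hne : c.castSucc ≠ c.succ := (Fin.castSucc_lt_succ).ne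
  rw [← Finset.sum_subset (Finset.subset_univ {c.castSucc, c.succ}), Finset.sum_pair hne]
  · simp [baseMatrix, hne.symm, sub_eq_add_neg]
  · intro r _ hr
    simp only [Finset.mem_insert, Finset.mem_singleton, not_or] at hr
    simp [baseMatrix, hr.1, hr.2]

/-- The syzygy relation given by column `c` of the canonical matrix. -/
def ColumnRel (p : paramSet t m → k) (F : Fin (t + 1) → Poly k) (c : Fin t) : Prop :=
  X 1 ^ dExp m c * F c.castSucc = X 0 * F c.succ - ∑ r, paramMatrix t m p r c * F r

lemma columnRel_iff {p : paramSet t m → k} {F : Fin (t + 1) → Poly k} {c : Fin t} :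
    ColumnRel p F c ↔ ∑ r, canonMatrix t m p r c * F r = 0 := by
  simp only [ColumnRel, canonMatrix, Matrix.add_apply, add_mul, Finset.sum_add_distrib,
    sum_baseMatrix_mul]
  constructor
  · intro h
    rw [h]; ring
  · intro h
    linear_combination h

/-- `F` is annihilated by the columns of the canonical matrix, and normalized. -/
structure IsChain (p : paramSet t m → k) (F : Fin (t + 1) → Poly k) : Prop where
  last : F (Fin.last t) = X 1 ^ m t
  rel : ∀ c, ColumnRel p F c

/-- The maximal minors of a `(t + 1) × t` matrix, with alternating signs. -/
def signedMinor (M : Matrix (Fin (t + 1)) (Fin t) (Poly k)) (r : Fin (t + 1)) : Poly k :=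
  (-1) ^ (t + r : ℕ) * (M.submatrix r.succAbove id).det

/-- Laplace expansion along the first column of the square matrix obtained by putting a second copy
of column `c` in front of `M`. -/
lemma sum_mul_signedMinor (M : Matrix (Fin (t + 1)) (Fin t) (Poly k)) (c : Fin t) :
    ∑ r, M r c * signedMinor M r = 0 := by
  let A : Matrix (Fin (t + 1)) (Fin (t + 1)) (Poly k) :=
    Matrix.of fun r => Fin.cons (M r c) (M r)
  have hA : A.det = 0 :=
    Matrix.det_zero_of_column_eq (Fin.succ_ne_zero c).symm fun r => by simp [A]
  rw [Matrix.det_succ_column_zero] at hA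
  have hsub : ∀ i : Fin (t + 1), A.submatrix i.succAbove Fin.succ = M.submatrix i.succAbove id :=
    fun i => by ext; simp [A]
  calc ∑ r, M r c * signedMinor M r
      = (-1) ^ t * ∑ i : Fin (t + 1), (-1) ^ (i : ℕ) * A i 0 *
          (A.submatrix i.succAbove Fin.succ).det := by
        rw [Finset.mul_sum]
        refine Finset.sum_congr rfl fun r _ => ?_
        rw [hsub, signedMinor, pow_add]
        simp only [A, Matrix.of_apply, Fin.cons_zero]
        ring
    _ = 0 := by rw [hA, mul_zero]

lemma span_signedMinor (M : Matrix (Fin (t + 1)) (Fin t) (Poly k)) :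
    Ideal.span (Set.range (signedMinor M)) = maxMinors M := by
  have hu : ∀ n : ℕ, ((-1 : Poly k) ^ n) * (-1) ^ n = 1 := fun n => by
    rw [← mul_pow]; simp
  apply le_antisymm
  on_goal 2 => rw [maxMinors]
  all_goals
    rw [Ideal.span_le]
    rintro _ ⟨r, rfl⟩
  · exact Ideal.mul_mem_left _ _ (Ideal.subset_span ⟨r, rfl⟩)
  · have : (M.submatrix r.succAbove id).det = (-1) ^ (t + r : ℕ) * signedMinor M r := by
      rw [signedMinor, ← mul_assoc, hu, one_mul]
    simp only [this]
    exact Ideal.mul_mem_left _ _ (Ideal.subset_span ⟨r, rfl⟩)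

lemma sum_dExp (hm : Monotone m) (hm0 : m 0 = 0) : ∑ c : Fin t, dExp m c = m t := by
  simp only [dExp]
  rw [Fin.sum_univ_eq_sum_range (fun c => m (c + 1) - m c) t, Finset.sum_range_tsub hm, hm0,
    Nat.sub_zero]

/-- Deleting the last row leaves a lower triangular matrix with diagonal entries y^{d_c}, and Σ d_c
telescopes to m_t. The sign convention of `signedMinor` makes the sign of this minor (-1)^{2t} = 1.
-/
lemma isChain_signedMinor (hm : Monotone m) (hm0 : m 0 = 0) (p : paramSet t m → k) :
    IsChain p (signedMinor (canonMatrix t m p)) := by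
  refine ⟨?_, fun c => columnRel_iff.mpr (sum_mul_signedMinor _ c)⟩
  have hent : ∀ i j : Fin t, i < j ∨ i = j →
      canonMatrix t m p i.castSucc j = if i = j then X 1 ^ dExp m j else 0 := by
    intro i j hij
    have hp : (i.castSucc, j) ∉ paramSet t m := fun h => by
      have := h.1
      simp only [Fin.val_castSucc] at this
      rcases hij with hij | rfl
      · exact absurd hij (not_lt.mpr (le_of_lt this))
      · omega
    rw [canonMatrix, Matrix.add_apply, paramMatrix_of_notMem hp, add_zero]
    have : i.castSucc ≠ j.succ := by
      rw [Ne, Fin.ext_iff]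
      simp only [Fin.val_castSucc, Fin.val_succ]
      rcases hij with hij | rfl
      · have : (i : ℕ) < j := hij
        omega
      · omega
    simp [baseMatrix, this]
  have hdet : ((canonMatrix t m p).submatrix (Fin.last t).succAbove id).det = X 1 ^ m t := by
    rw [Matrix.det_of_isLowerTriangular]
    · simp only [Matrix.submatrix_apply, Fin.succAbove_last, id]
      rw [Finset.prod_congr rfl fun i _ => (hent i i (Or.inr rfl)).trans (if_pos rfl),
        Finset.prod_pow_eq_pow_sum, sum_dExp hm hm0]
    · intro i j hij
      have hij : i < j := hij
      simp only [Matrix.submatrix_apply, Fin.succAbove_last, id]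
      rw [hent i j (Or.inl hij), if_neg hij.ne]
  rw [signedMinor, hdet, Fin.val_last, ← two_mul, pow_mul]
  simp

/-- Descending induction along the rows. -/
lemma row_induction {P : Fin (t + 1) → Prop} (last : P (Fin.last t))
    (step : ∀ c : Fin t, (∀ r, c.castSucc < r → P r) → P c.castSucc) (r : Fin (t + 1)) : P r := by
  induction r using WellFoundedGT.induction with
  | ind r ih =>
    rcases Fin.eq_castSucc_or_eq_last r with ⟨c, rfl⟩ | rfl
    · exact step c ih
    · exact last

lemma lt_of_mem_paramSet {r : Fin (t + 1)} {c : Fin t} (h : (r, c) ∈ paramSet t m) :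
    c.castSucc < r := h.1

lemma sum_paramMatrix_congr {p : paramSet t m → k} {F G : Fin (t + 1) → Poly k} {c : Fin t}
    (h : ∀ r, c.castSucc < r → F r = G r) :
    ∑ r, paramMatrix t m p r c * F r = ∑ r, paramMatrix t m p r c * G r := by
  refine Finset.sum_congr rfl fun r _ => ?_
  by_cases hr : (r, c) ∈ paramSet t m
  · rw [h r (lt_of_mem_paramSet hr)]
  · simp [paramMatrix_of_notMem hr]

lemma X_one_pow_ne_zero (n : ℕ) : (X 1 ^ n : Poly k) ≠ 0 := pow_ne_zero _ (X_ne_zero 1)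

lemma ColumnRel.eq_of_eq {p : paramSet t m → k} {F G : Fin (t + 1) → Poly k} {c : Fin t}
    (hF : ColumnRel p F c) (hG : ColumnRel p G c) (h : ∀ r, c.castSucc < r → F r = G r) :
    F c.castSucc = G c.castSucc := by
  refine mul_left_cancel₀ (X_one_pow_ne_zero (dExp m c)) ?_
  rw [hF, hG, h _ Fin.castSucc_lt_succ, sum_paramMatrix_congr h]

/-- Identifies any chain for `p` with the signed minors, so that later arguments use only the
recursion and no determinants. -/
lemma IsChain.unique {p : paramSet t m → k} {F G : Fin (t + 1) → Poly k}
    (hF : IsChain p F) (hG : IsChain p G) : F = G := by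
  funext r
  induction r using row_induction with
  | last => rw [hF.last, hG.last]
  | step c ih => exact (hF.rel c).eq_of_eq (hG.rel c) ih

/-! ### Leading terms and degrees -/

lemma sum_paramMatrix_mem_xLT {p : paramSet t m → k} {F : Fin (t + 1) → Poly k} {c : Fin t}
    (h : ∀ r, c.castSucc < r → IsLead (F r) (t - r) (m r)) :
    ∑ r, paramMatrix t m p r c * F r ∈ xLT k (t - c) := by
  refine Submodule.sum_mem _ fun r _ => ?_
  by_cases hr : (r, c) ∈ paramSet t m
  · have hlt : (c : ℕ) < r := hr.1
    rw [paramMatrix_of_mem hr]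
    exact (h r (lt_of_mem_paramSet hr)).smul_mem_xLT (by omega) _ _
  · simp [paramMatrix_of_notMem hr]

/-- Kept to a single column so that it also applies to the partial chains of the surjectivity proof.
-/
lemma ColumnRel.isLead (hm : Monotone m) {p : paramSet t m → k} {F : Fin (t + 1) → Poly k}
    {c : Fin t} (hF : ColumnRel p F c) (h : ∀ r, c.castSucc < r → IsLead (F r) (t - r) (m r)) :
    IsLead (F c.castSucc) (t - c) (m c) := by
  refine IsLead.of_X_one_pow_mul (n := dExp m c) ?_
  rw [hF]
  refine IsLead.sub ?_ (sum_paramMatrix_mem_xLT h)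
  have h1 := isLead_X_zero.mul (h _ (Fin.castSucc_lt_succ (i := c)))
  have hmc : m c ≤ m (c + 1) := hm (Nat.le_succ c)
  convert h1 using 1
  · rw [Fin.val_succ]; omega
  · simp only [dExp, Fin.val_succ]; omega

/-- The degree of the generator belonging to row `r`, as a natural number. -/
def genDeg (m : ℕ → ℕ) (r : Fin (t + 1)) : ℕ := t - r + m r

lemma rowDeg_eq (r : Fin (t + 1)) : rowDeg m r = genDeg m r := by
  simp only [rowDeg, genDeg]
  omega

lemma uDeg_eq (hm : Monotone m) (r : Fin (t + 1)) (c : Fin t) :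
    uDeg m r c = (dExp m c + genDeg m c.castSucc : ℕ) - (genDeg m r : ℤ) := by
  have hmc : m c ≤ m (c + 1) := hm (Nat.le_succ c)
  simp only [uDeg, genDeg, dExp, Fin.val_castSucc]
  omega

/-- Since u_{rc} = d_c + deg F_c - deg F_r, the bounds 0 ≤ u_{rc} < d_c are bounds on the degree of
F_r. -/
lemma mem_paramSet_iff (hm : Monotone m) {r : Fin (t + 1)} {c : Fin t} :
    (r, c) ∈ paramSet t m ↔ c.castSucc < r ∧ genDeg m c.castSucc < genDeg m r ∧
      genDeg m r ≤ dExp m c + genDeg m c.castSucc := by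
  simp only [paramSet, Set.mem_ofPred_eq, uDeg_eq hm, Fin.lt_def, Fin.val_castSucc]
  omega

lemma genDeg_succ (hm : Monotone m) (c : Fin t) :
    1 + genDeg m c.succ = dExp m c + genDeg m c.castSucc := by
  have hmc : m c ≤ m (c + 1) := hm (Nat.le_succ c)
  simp only [genDeg, dExp, Fin.val_castSucc, Fin.val_succ]
  omega

lemma ColumnRel.isHomogeneous (hm : Monotone m) {p : paramSet t m → k}
    {F : Fin (t + 1) → Poly k} {c : Fin t} (hF : ColumnRel p F c)
    (h : ∀ r, c.castSucc < r → (F r).IsHomogeneous (genDeg m r)) :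
    (F c.castSucc).IsHomogeneous (genDeg m c.castSucc) := by
  refine IsHomogeneous.of_X_one_pow_mul (n := dExp m c) ?_
  rw [hF]
  refine IsHomogeneous.sub ?_ (IsHomogeneous.sum _ _ _ fun r _ => ?_)
  · rw [← genDeg_succ hm]
    exact (isHomogeneous_X _ _).mul (h _ Fin.castSucc_lt_succ)
  · by_cases hr : (r, c) ∈ paramSet t m
    · rw [paramMatrix_of_mem hr]
      have h1 := ((isHomogeneous_C (Fin 2) (p ⟨(r, c), hr⟩)).mul
        (isHomogeneous_X_pow (1 : Fin 2) (uDeg m r c).toNat)).mul (h r (lt_of_mem_paramSet hr))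
      have h2 := hr.2.1
      have h3 : 0 + (uDeg m r c).toNat + genDeg m r = dExp m c + genDeg m c.castSucc := by
        simp only [uDeg_eq hm] at h2 ⊢
        omega
      rwa [h3] at h1
    · simp [paramMatrix_of_notMem hr, isHomogeneous_zero]

variable {p : paramSet t m → k} {F : Fin (t + 1) → Poly k}

lemma IsChain.isLead (hm : Monotone m) (hF : IsChain p F) (r : Fin (t + 1)) :
    IsLead (F r) (t - r) (m r) := by
  induction r using row_induction with
  | last => simpa [hF.last] using isLead_X_one_pow (k := k) (m t)
  | step c ih => exact (hF.rel c).isLead hm ih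

lemma IsChain.isHomogeneous (hm : Monotone m) (hF : IsChain p F) (r : Fin (t + 1)) :
    (F r).IsHomogeneous (genDeg m r) := by
  induction r using row_induction with
  | last => simpa [hF.last, genDeg] using isHomogeneous_X_pow (R := k) (1 : Fin 2) (m t)
  | step c ih => exact (hF.rel c).isHomogeneous hm ih

lemma IsChain.span_eq (hm : Monotone m) (hm0 : m 0 = 0) (hF : IsChain p F) :
    Ideal.span (Set.range F) = maxMinors (canonMatrix t m p) := by
  rw [hF.unique (isChain_signedMinor hm hm0 p), span_signedMinor]

lemma IsChain.span_isHomogeneous (hm : Monotone m) (hF : IsChain p F) :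
    (Ideal.span (Set.range F)).IsHomogeneous (homogeneousSubmodule (Fin 2) k) := by
  refine Ideal.homogeneous_span _ _ ?_
  rintro _ ⟨r, rfl⟩
  exact ⟨_, hF.isHomogeneous hm r⟩

end Chain

/-! ### Normal forms modulo the columns, and the Hilbert–Burch theorem -/

section NormalForm

variable {k : Type*} [Field k] {t : ℕ} {m : ℕ → ℕ}

lemma degree_zero_of_mem_supported {g : Poly k} (h : g ∈ supported k ({1} : Set (Fin 2))) :
    lexOrd.degree g 0 = 0 := by
  by_contra hne
  have hg : g ≠ 0 := by
    rintro rfl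
    simp at hne
  have : (0 : Fin 2) ∈ g.vars :=
    (mem_vars_iff_mem_support 0).mpr ⟨_, MonomialOrder.degree_mem_support hg, Finsupp.mem_support_iff.mpr hne⟩
  simpa using mem_supported.mp h this

variable (k t) in
/-- The vectors whose entries, except for the first one, are polynomials in `y`. -/
def normalVec : Submodule k (Fin (t + 1) → Poly k) where
  carrier := {g | ∀ r, r ≠ 0 → g r ∈ supported k ({1} : Set (Fin 2))}
  add_mem' ha hb r hr := add_mem (ha r hr) (hb r hr)
  zero_mem' _ _ := zero_mem _
  smul_mem' a _ hg r hr := Subalgebra.smul_mem _ (hg r hr) a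

lemma smul_mem_normalVec {s : Poly k} (hs : s ∈ supported k ({1} : Set (Fin 2)))
    {g : Fin (t + 1) → Poly k} (hg : g ∈ normalVec k t) : s • g ∈ normalVec k t :=
  fun r hr => mul_mem hs (hg r hr)

/-- The column space of the canonical matrix. -/
def colSpan (p : paramSet t m → k) : Submodule (Poly k) (Fin (t + 1) → Poly k) :=
  Submodule.span (Poly k) (Set.range fun c r => canonMatrix t m p r c)

lemma X_one_mem_supported : (X 1 : Poly k) ∈ supported k ({1} : Set (Fin 2)) :=
  X_mem_supported.mpr rfl

lemma canonMatrix_add_mem_supported (p : paramSet t m → k) (r : Fin (t + 1)) (c : Fin t) :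
    canonMatrix t m p r c + X 0 * Pi.single (M := fun _ => Poly k) c.succ 1 r ∈
      supported k ({1} : Set (Fin 2)) := by
  have hN : paramMatrix t m p r c ∈ supported k ({1} : Set (Fin 2)) := by
    by_cases hr : (r, c) ∈ paramSet t m
    · rw [paramMatrix_of_mem hr]
      exact mul_mem (Subalgebra.algebraMap_mem _ _) (pow_mem X_one_mem_supported _)
    · rw [paramMatrix_of_notMem hr]
      exact zero_mem _
  have hB : baseMatrix k t m r c + X 0 * Pi.single (M := fun _ => Poly k) c.succ 1 r ∈
      supported k ({1} : Set (Fin 2)) := by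
    have hne : c.castSucc ≠ c.succ := (Fin.castSucc_lt_succ).ne
    by_cases h1 : r = c.castSucc
    · subst h1
      simpa [baseMatrix, hne] using pow_mem X_one_mem_supported _
    · by_cases h2 : r = c.succ
      · subst h2
        simp [baseMatrix, hne.symm]
      · simp [baseMatrix, h1, h2]
  have := add_mem hB hN
  rw [canonMatrix, Matrix.add_apply]
  convert this using 1
  ring

/-- The sum of the normal vectors and the column space is stable under y and x, hence under all
polynomials, and it contains the unit vectors. -/
lemma exists_normalVec (p : paramSet t m → k) (g : Fin (t + 1) → Poly k) :
    ∃ n ∈ normalVec k t, g - n ∈ colSpan p := by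
  classical
  set L : Submodule k (Fin (t + 1) → Poly k) := normalVec k t ⊔ (colSpan p).restrictScalars k
    with hL
  have hN : normalVec k t ≤ L := le_sup_left
  have hK : (colSpan p).restrictScalars k ≤ L := le_sup_right
  have hy : ∀ v ∈ L, (X 1 : Poly k) • v ∈ L := by
    intro v hv
    obtain ⟨n, hn, w, hw, rfl⟩ := Submodule.mem_sup.mp hv
    rw [smul_add]
    exact add_mem (hN (smul_mem_normalVec X_one_mem_supported hn))
      (hK (Submodule.smul_mem (colSpan p) _ hw))
  have hx : ∀ v ∈ L, (X 0 : Poly k) • v ∈ L := by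
    intro v hv
    obtain ⟨n, hn, w, hw, rfl⟩ := Submodule.mem_sup.mp hv
    rw [smul_add]
    refine add_mem ?_ (hK (Submodule.smul_mem (colSpan p) _ hw))
    have hsum : (X 0 : Poly k) • n = ∑ r, Pi.single r (X 0 * n r) := by
      rw [Finset.univ_sum_single fun r => X 0 * n r]; rfl
    rw [hsum]
    refine Submodule.sum_mem _ fun r _ => ?_
    -- Row 0 may keep its x. In row c + 1 the factor x is removed by adding n_{c+1} times column c,
    -- whose only entry involving x is the -x in that row; n_{c+1} lies in k[y], so the result is
    -- again normal.
    rcases Fin.eq_zero_or_eq_succ r with rfl | ⟨c, rfl⟩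
    · exact hN fun r hr => by simp [Pi.single_eq_of_ne hr]
    · have heq : (Pi.single c.succ (X 0 * n c.succ) : Fin (t + 1) → Poly k) =
          n c.succ • (fun r => canonMatrix t m p r c +
            X 0 * Pi.single (M := fun _ => Poly k) c.succ 1 r) -
          n c.succ • (fun r => canonMatrix t m p r c) := by
        funext r
        by_cases hr : r = c.succ
        · subst hr; simp; ring
        · simp [hr]
      rw [heq]
      refine sub_mem (hN (smul_mem_normalVec (hn _ (Fin.succ_ne_zero c)) fun r _ => ?_))
        (hK (Submodule.smul_mem (colSpan p) _ (Submodule.subset_span ⟨c, rfl⟩)))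
      exact canonMatrix_add_mem_supported p r c
  have hsmul : ∀ (f : Poly k), ∀ v ∈ L, f • v ∈ L := by
    intro f
    induction f using MvPolynomial.induction_on with
    | C a =>
      intro v hv
      rw [← algebraMap_eq, algebraMap_smul]
      exact Submodule.smul_mem _ _ hv
    | add f g hf hg =>
      intro v hv
      rw [add_smul]
      exact add_mem (hf v hv) (hg v hv)
    | mul_X f i hf =>
      intro v hv
      rw [mul_smul]
      fin_cases i
      · exact hf _ (hx v hv)
      · exact hf _ (hy v hv)
  have hg : g ∈ L := by
    have : g = ∑ r, g r • (Pi.single r 1 : Fin (t + 1) → Poly k) := by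
      rw [← Finset.univ_sum_single g]
      refine Finset.sum_congr rfl fun r _ => ?_
      rw [Finset.univ_sum_single g]
      funext s
      by_cases hs : s = r
      · subst hs; simp
      · simp [hs]
    rw [this]
    refine Submodule.sum_mem _ fun r _ => hsmul _ _ (hN fun s _ => ?_)
    by_cases hs : s = r
    · subst hs; simp
    · simp [hs]
  obtain ⟨n, hn, w, hw, h⟩ := Submodule.mem_sup.mp hg
  exact ⟨n, hn, by rw [← h, add_sub_cancel_left]; exact hw⟩

lemma sum_mul_eq_zero_of_mem_colSpan {p : paramSet t m → k} {F : Fin (t + 1) → Poly k}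
    (hF : IsChain p F) {g : Fin (t + 1) → Poly k} (hg : g ∈ colSpan p) :
    ∑ r, g r * F r = 0 := by
  induction hg using Submodule.span_induction with
  | mem _ h =>
    obtain ⟨c, rfl⟩ := h
    exact columnRel_iff.mp (hF.rel c)
  | zero => simp
  | add a b _ _ ha hb => simp [add_mul, Finset.sum_add_distrib, ha, hb]
  | smul a g _ hg => simp [mul_assoc, ← Finset.mul_sum, hg]

/-- The leading monomial of a nontrivial combination in normal form. -/
lemma exists_le_degree_of_normalVec {F : Fin (t + 1) → Poly k}
    (hF : ∀ r, IsLead (F r) (t - r) (m r)) {g : Fin (t + 1) → Poly k} (hg : g ∈ normalVec k t)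
    (h0 : g ≠ 0) : (∑ r, g r * F r) ≠ 0 ∧
      ∃ r : Fin (t + 1), mon (t - r) (m r) ≤ lexOrd.degree (∑ r, g r * F r) := by
  classical
  have hsum : ∑ r, g r * F r = ∑ r ∈ Finset.univ.filter fun r => g r ≠ 0, g r * F r := by
    rw [Finset.sum_filter_of_ne]
    intro r _ hr hgr
    simp [hgr] at hr
  have hdeg : ∀ r, g r ≠ 0 →
      lexOrd.degree (g r * F r) = lexOrd.degree (g r) + mon (t - r) (m r) := fun r hr => by
    rw [MonomialOrder.degree_mul hr (hF r).ne_zero, (hF r).1]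
  -- The x-exponent is exactly t - r < t in row r ≠ 0 and at least t in row 0, so different rows
  -- have different leading monomials.
  have hfst : ∀ r : Fin (t + 1), g r ≠ 0 → r ≠ 0 → lexOrd.degree (g r * F r) 0 = t - r :=
    fun r hr hr0 => by
      rw [hdeg r hr]
      simp [degree_zero_of_mem_supported (hg r hr0)]
  have hfst0 : g 0 ≠ 0 → t ≤ lexOrd.degree (g 0 * F 0) 0 := fun hr => by
    rw [hdeg 0 hr]
    simp
  obtain ⟨r, hr⟩ := Function.ne_iff.mp h0
  obtain ⟨h1, r, hr, h2⟩ := exists_degree_sum_eq (Finset.univ.filter fun r => g r ≠ 0)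
    ⟨r, by simpa using hr⟩ (fun r => g r * F r)
    (fun r hr => mul_ne_zero (by simpa using hr) (hF r).ne_zero) (by
      intro i hi j hj hij
      have hi : g i ≠ 0 := by simpa using hi
      have hj : g j ≠ 0 := by simpa using hj
      have h0 := DFunLike.congr_fun hij 0
      have hit := i.is_le
      have hjt := j.is_le
      by_cases hi0 : i = 0 <;> by_cases hj0 : j = 0
      · rw [hi0, hj0]
      · subst hi0
        have := hfst0 hi
        have := Fin.pos_of_ne_zero hj0
        have h3 : 0 < (j : ℕ) := this
        rw [hfst j hj hj0] at h0
        omega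
      · subst hj0
        have := hfst0 hj
        have := Fin.pos_of_ne_zero hi0
        have h3 : 0 < (i : ℕ) := this
        rw [hfst i hi hi0] at h0
        omega
      · rw [hfst i hi hi0, hfst j hj hj0] at h0
        exact Fin.ext (by omega))
  rw [hsum]
  refine ⟨h1, r, ?_⟩
  rw [h2, hdeg r (by simpa using hr)]
  exact le_add_self

/-- The syzygies of the maximal minors are generated by the columns. -/
lemma IsChain.mem_colSpan (hm : Monotone m) {p : paramSet t m → k} {F : Fin (t + 1) → Poly k}
    (hF : IsChain p F) {g : Fin (t + 1) → Poly k} (hg : ∑ r, g r * F r = 0) :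
    g ∈ colSpan p := by
  obtain ⟨n, hn, h⟩ := exists_normalVec p g
  have h1 := sum_mul_eq_zero_of_mem_colSpan hF h
  simp only [Pi.sub_apply, sub_mul, Finset.sum_sub_distrib, hg, zero_sub, neg_eq_zero] at h1
  by_cases hn0 : n = 0
  · simpa [hn0] using h
  · exact absurd h1 (exists_le_degree_of_normalVec (hF.isLead hm) hn hn0).1

/-- The initial ideal of the ideal generated by a chain. -/
lemma IsChain.leadIdeal_span (hm : Monotone m) {p : paramSet t m → k}
    {F : Fin (t + 1) → Poly k} (hF : IsChain p F) :
    leadIdeal (Ideal.span (Set.range F)) =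
      Ideal.span (Set.range fun r : Fin (t + 1) => monomial (mon (t - r) (m r)) (1 : k)) := by
  apply le_antisymm
  · rw [leadIdeal, Ideal.span_le]
    rintro _ ⟨f, hf, hf0, rfl⟩
    obtain ⟨g, rfl⟩ := Ideal.mem_span_range_iff_exists_fun.mp hf
    obtain ⟨n, hn, h⟩ := exists_normalVec p g
    have h1 := sum_mul_eq_zero_of_mem_colSpan hF h
    simp only [Pi.sub_apply, sub_mul, Finset.sum_sub_distrib, sub_eq_zero] at h1
    rw [h1] at hf0 ⊢
    have hn0 : n ≠ 0 := by
      rintro rfl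
      simp at hf0
    obtain ⟨-, r, hr⟩ := exists_le_degree_of_normalVec (hF.isLead hm) hn hn0
    rw [← tsub_add_cancel_of_le hr, ← mul_one (1 : k), ← monomial_mul]
    exact Ideal.mul_mem_left _ _ (Ideal.subset_span ⟨r, by simp⟩)
  · rw [Ideal.span_le]
    rintro _ ⟨r, rfl⟩
    exact Ideal.subset_span ⟨F r, Ideal.subset_span ⟨r, rfl⟩, (hF.isLead hm r).ne_zero,
      by rw [(hF.isLead hm r).1]⟩

end NormalForm

/-! ### Monomial ideals of finite colength -/

section MonomialIdeal

variable {k : Type*} [Field k] {E : Ideal (Poly k)}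

lemma monomial_mem_of_le {I : Ideal (Poly k)} {d e : Fin 2 →₀ ℕ} (h : d ≤ e)
    (hd : monomial d (1 : k) ∈ I) : monomial e (1 : k) ∈ I := by
  rw [← tsub_add_cancel_of_le h, ← mul_one (1 : k), ← monomial_mul]
  exact Ideal.mul_mem_left _ _ hd

lemma IsMonomialIdeal.monomial_mem (hE : IsMonomialIdeal E) {f : Poly k} (hf : f ∈ E)
    {e : Fin 2 →₀ ℕ} (he : e ∈ f.support) : monomial e (1 : k) ∈ E := by
  obtain ⟨S, rfl⟩ := hE
  obtain ⟨d, hd, hde⟩ := mem_ideal_span_monomial_image.mp hf e he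
  exact monomial_mem_of_le hde (Ideal.subset_span ⟨d, hd, rfl⟩)

/-- In the finite-dimensional quotient the variable is integral over k; its monic equation is an
element of `E`, and a monomial ideal contains the top monomial of that element. -/
lemma IsMonomialIdeal.exists_X_pow_mem (hE : IsMonomialIdeal E)
    (hfin : Module.Finite k (Poly k ⧸ E)) (i : Fin 2) : ∃ j, (X i : Poly k) ^ j ∈ E := by
  obtain ⟨q, hq, h⟩ := IsIntegral.of_finite k (Ideal.Quotient.mkₐ k E (X i))
  rw [← Polynomial.aeval_def, Polynomial.aeval_algHom_apply, Ideal.Quotient.mkₐ_eq_mk,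
    Ideal.Quotient.eq_zero_iff_mem] at h
  refine ⟨q.natDegree, ?_⟩
  rw [X_pow_eq_monomial]
  refine hE.monomial_mem h ?_
  rw [mem_support_iff, Polynomial.aeval_eq_sum_range, coeff_sum,
    Finset.sum_eq_single_of_mem q.natDegree (by simp)]
  · simp [X_pow_eq_monomial, hq.coeff_natDegree]
  · intro j _ hj
    simp [X_pow_eq_monomial, coeff_monomial, (Finsupp.single_injective i).ne hj]

lemma X_zero_pow_tOf_mem (hE : IsMonomialIdeal E) (hfin : Module.Finite k (Poly k ⧸ E)) :
    (X 0 : Poly k) ^ tOf E ∈ E :=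
  Nat.sInf_mem (s := {j | (X 0 : Poly k) ^ j ∈ E}) (hE.exists_X_pow_mem hfin 0)

lemma X_pow_mul_mOf_mem (hE : IsMonomialIdeal E) (hfin : Module.Finite k (Poly k ⧸ E))
    (i : ℕ) : (X 0 : Poly k) ^ (tOf E - i) * X 1 ^ mOf E i ∈ E := by
  obtain ⟨j, hj⟩ := hE.exists_X_pow_mem hfin 1
  exact Nat.sInf_mem (s := {j | (X 0 : Poly k) ^ (tOf E - i) * X 1 ^ j ∈ E})
    ⟨j, Ideal.mul_mem_left _ _ hj⟩

lemma mOf_monotone (hE : IsMonomialIdeal E) (hfin : Module.Finite k (Poly k ⧸ E)) :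
    Monotone (mOf E) := by
  intro i j hij
  refine Nat.sInf_le ?_
  have h := Ideal.mul_mem_left _ ((X 0 : Poly k) ^ ((tOf E - i) - (tOf E - j)))
    (X_pow_mul_mOf_mem hE hfin j)
  rwa [← mul_assoc, ← pow_add, Nat.sub_add_cancel (by omega)] at h

lemma mOf_zero (hE : IsMonomialIdeal E) (hfin : Module.Finite k (Poly k ⧸ E)) :
    mOf E 0 = 0 := by
  refine Nat.eq_zero_of_le_zero (Nat.sInf_le ?_)
  simpa using X_zero_pow_tOf_mem hE hfin

lemma monomial_mon_mOf_mem (hE : IsMonomialIdeal E) (hfin : Module.Finite k (Poly k ⧸ E))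
    (i : ℕ) : monomial (mon (tOf E - i) (mOf E i)) (1 : k) ∈ E := by
  rw [monomial_mon]
  exact X_pow_mul_mOf_mem hE hfin i

lemma mOf_le_of_mem {i e : ℕ} (h : monomial (mon (tOf E - i) e) (1 : k) ∈ E) : mOf E i ≤ e := by
  rw [monomial_mon] at h
  exact Nat.sInf_le h

lemma IsMonomialIdeal.eq_span (hE : IsMonomialIdeal E) (hfin : Module.Finite k (Poly k ⧸ E)) :
    E = Ideal.span (Set.range fun r : Fin (tOf E + 1) =>
      monomial (mon (tOf E - r) (mOf E r)) (1 : k)) := by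
  apply le_antisymm
  · have hle : ∀ e, monomial e (1 : k) ∈ E → monomial e (1 : k) ∈
        Ideal.span (Set.range fun r : Fin (tOf E + 1) =>
          monomial (mon (tOf E - r) (mOf E r)) (1 : k)) := by
      intro e he
      -- The subtraction is truncated: for `e 0 > t` the row is 0, where m_0 = 0.
      have hr : tOf E - e 0 < tOf E + 1 := by omega
      refine monomial_mem_of_le (d := mon (tOf E - (tOf E - e 0)) (mOf E (tOf E - e 0)))
        (exponent_le.mpr ⟨by simp; omega, ?_⟩) (Ideal.subset_span ⟨⟨_, hr⟩, rfl⟩)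
      rw [mon_apply_one]
      by_cases h : e 0 ≤ tOf E
      · refine mOf_le_of_mem ?_
        rwa [Nat.sub_sub_self h, ← eq_mon]
      · rw [Nat.sub_eq_zero_of_le (by omega), mOf_zero hE hfin]
        exact Nat.zero_le _
    obtain ⟨S, hS⟩ := id hE
    conv_lhs => rw [hS]
    rw [Ideal.span_le]
    rintro _ ⟨e, he, rfl⟩
    exact hle e (hS ▸ Ideal.subset_span ⟨e, he, rfl⟩)
  · rw [Ideal.span_le]
    rintro _ ⟨r, rfl⟩
    exact monomial_mon_mOf_mem hE hfin r

end MonomialIdeal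

/-! ### Ideals with a given initial ideal -/

section LeadIdeal

variable {k : Type*} [Field k]

lemma exists_isLead_of_mem_leadIdeal {I : Ideal (Poly k)} {s e : ℕ}
    (h : monomial (mon s e) (1 : k) ∈ leadIdeal I) : ∃ g ∈ I, IsLead g s e := by
  classical
  have hI : leadIdeal I = Ideal.span ((fun d => monomial d (1 : k)) ''
      {d | ∃ f ∈ I, f ≠ 0 ∧ d = lexOrd.degree f}) := by
    rw [leadIdeal]
    congr 1
    ext g
    constructor
    · rintro ⟨f, hf, h0, rfl⟩
      exact ⟨_, ⟨f, hf, h0, rfl⟩, rfl⟩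
    · rintro ⟨_, ⟨f, hf, h0, rfl⟩, rfl⟩
      exact ⟨f, hf, h0, rfl⟩
  rw [hI] at h
  obtain ⟨_, ⟨f, hf, h0, rfl⟩, hle⟩ :=
    mem_ideal_span_monomial_image.mp h (mon s e) (by simp [mem_support_iff])
  have hlc := lexOrd.leadingCoeff_ne_zero_iff.mpr h0
  have hne : monomial (mon s e - lexOrd.degree f) (lexOrd.leadingCoeff f)⁻¹ ≠ 0 := by
    simpa using h0
  refine ⟨monomial (mon s e - lexOrd.degree f) (lexOrd.leadingCoeff f)⁻¹ * f,
    Ideal.mul_mem_left _ _ hf, ?_, ?_⟩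
  · rw [MonomialOrder.degree_mul hne h0, MonomialOrder.degree_monomial,
      if_neg (inv_ne_zero hlc), tsub_add_cancel_of_le hle]
  · rw [MonomialOrder.leadingCoeff_mul_of_left_mem_nonZeroDivisors (by simpa using h0),
      MonomialOrder.leadingCoeff_monomial, inv_mul_cancel₀ hlc]

/-- The homogeneous component that contains the leading monomial stays in `I` and keeps its leading
term. -/
lemma exists_isHomogeneous_isLead {I : Ideal (Poly k)}
    (hI : I.IsHomogeneous (homogeneousSubmodule (Fin 2) k)) {s e : ℕ}
    (h : monomial (mon s e) (1 : k) ∈ leadIdeal I) :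
    ∃ g ∈ I, g.IsHomogeneous (s + e) ∧ IsLead g s e := by
  obtain ⟨g, hg, hlead⟩ := exists_isLead_of_mem_leadIdeal h
  refine ⟨homogeneousComponent (s + e) g, homogeneousComponent_mem_of_mem hI hg _,
    homogeneousComponent_isHomogeneous _ _, ?_⟩
  have hc : coeff (mon s e) (homogeneousComponent (s + e) g) = 1 := by
    rw [coeff_homogeneousComponent, if_pos (by simp [exponent_degree]), hlead.coeff]
  have hd : lexOrd.degree (homogeneousComponent (s + e) g) = mon s e := by
    apply lexOrd.toSyn.injective
    apply le_antisymm
    · rw [MonomialOrder.degree_le_iff]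
      intro d hd
      rw [← hlead.1]
      refine lexOrd.le_degree ?_
      rw [mem_support_iff, coeff_homogeneousComponent] at hd
      rw [mem_support_iff]
      intro h0
      simp [h0] at hd
    · refine lexOrd.le_degree ?_
      rw [mem_support_iff, hc]
      exact one_ne_zero
  exact ⟨hd, by rw [MonomialOrder.leadingCoeff, hd, hc]⟩

/-- Division with remainder: subtracting an element of `J` with the same leading term lowers the
leading monomial, and the lexicographic order is a well-order. -/
lemma eq_of_le_of_leadIdeal_le {I J : Ideal (Poly k)} (hJI : J ≤ I)
    (h : leadIdeal I ≤ leadIdeal J) : J = I := by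
  refine le_antisymm hJI fun f hf => ?_
  generalize hd : lexOrd.toSyn (lexOrd.degree f) = d
  induction d using WellFoundedLT.induction generalizing f with
  | ind d ih =>
    by_cases h0 : f = 0
    · rw [h0]; exact zero_mem _
    have hlead : monomial (mon (lexOrd.degree f 0) (lexOrd.degree f 1)) (1 : k) ∈ leadIdeal J := by
      rw [← eq_mon]
      exact h (Ideal.subset_span ⟨f, hf, h0, rfl⟩)
    obtain ⟨g, hg, hgl⟩ := exists_isLead_of_mem_leadIdeal hlead
    have hgd : lexOrd.degree g = lexOrd.degree f := by rw [hgl.1, ← eq_mon]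
    have hsub : f - lexOrd.leadingCoeff f • g ∈ J := by
      by_cases h1 : f - lexOrd.leadingCoeff f • g = 0
      · rw [h1]; exact zero_mem _
      refine ih _ ?_ _ (sub_mem hf (Submodule.smul_of_tower_mem I _ (hJI hg))) rfl
      rw [← hd]
      refine lt_of_le_of_ne ?_ fun heq => ?_
      · rw [sub_eq_add_neg, ← neg_smul]
        refine MonomialOrder.degree_add_le.trans (sup_le le_rfl ?_)
        exact MonomialOrder.degree_smul_le.trans_eq (by rw [hgd])
      · have heq := lexOrd.toSyn.injective heq
        refine h1 (MonomialOrder.coeff_degree_eq_zero_iff (m := lexOrd).mp ?_)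
        have hg1 : coeff (lexOrd.degree f) g = 1 := by rw [← hgd]; exact hgl.2
        rw [heq, coeff_sub, coeff_smul, hg1, MonomialOrder.leadingCoeff, smul_eq_mul, mul_one,
          sub_self]
    have := add_mem hsub (Submodule.smul_of_tower_mem J (lexOrd.leadingCoeff f) hg)
    rwa [sub_add_cancel] at this

end LeadIdeal

/-! ### Injectivity of the parametrization -/

section Injectivity

variable {k : Type*} [Field k] {t : ℕ} {m : ℕ → ℕ} {p q : paramSet t m → k}
  {F G : Fin (t + 1) → Poly k}

lemma IsChain.le_of_mem_leadIdeal (hm : Monotone m) (hF : IsChain p F) {r : Fin (t + 1)} {e : ℕ}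
    (h : monomial (mon (t - r) e) (1 : k) ∈ leadIdeal (Ideal.span (Set.range F))) : m r ≤ e := by
  have hS : (Set.range fun r : Fin (t + 1) => monomial (mon (t - r) (m r)) (1 : k)) =
      (fun d => monomial d (1 : k)) '' Set.range fun r : Fin (t + 1) => mon (t - r) (m r) := by
    rw [← Set.range_comp]; rfl
  rw [hF.leadIdeal_span hm, hS] at h
  obtain ⟨_, ⟨s, rfl⟩, hle⟩ :=
    mem_ideal_span_monomial_image.mp h (mon (t - r) e) (by simp [mem_support_iff])
  rw [exponent_le] at hle
  simp only [mon_apply_zero, mon_apply_one] at hle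
  have hr := r.is_le
  have hs := s.is_le
  exact (hm (show (r : ℕ) ≤ s by omega)).trans hle.2

/-- Chains in the same ideal that agree below row `c` have the same parameters in column `c`. -/
lemma IsChain.column_eq (hm : Monotone m) (hF : IsChain p F) (hG : IsChain q G)
    (hI : Ideal.span (Set.range F) = Ideal.span (Set.range G)) {c : Fin t}
    (hFG : ∀ r, c.castSucc < r → F r = G r) (r : Fin (t + 1)) (h : (r, c) ∈ paramSet t m) :
    p ⟨(r, c), h⟩ = q ⟨(r, c), h⟩ := by
  classical
  by_contra hne
  let δ : Fin (t + 1) → k := fun r =>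
    if h : (r, c) ∈ paramSet t m then q ⟨(r, c), h⟩ - p ⟨(r, c), h⟩ else 0
  have hδmem : ∀ r, δ r ≠ 0 → (r, c) ∈ paramSet t m := fun r hr => by
    by_contra hn
    simp [δ, hn] at hr
  have hδ : δ r ≠ 0 := by
    simpa [δ, h, sub_eq_zero] using fun h => hne h.symm
  let T : Fin (t + 1) → Poly k := fun r => C (δ r) * X 1 ^ (uDeg m r c).toNat * F r
  -- Subtracting the two relations of column `c`: the terms in x and in the common rows cancel up to
  -- the differences of parameters.
  have hsum : X 1 ^ dExp m c * (F c.castSucc - G c.castSucc) =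
      ∑ r ∈ Finset.univ.filter fun r => δ r ≠ 0, T r := by
    have hT : ∀ r ∈ Finset.univ, T r ≠ 0 → δ r ≠ 0 := fun r _ hr h0 => hr (by simp [T, h0])
    rw [Finset.sum_filter_of_ne hT, mul_sub, hF.rel c,
      hG.rel c, hFG _ Fin.castSucc_lt_succ, sub_sub_sub_cancel_left, sum_paramMatrix_congr
      (fun r hr => (hFG r hr).symm), ← Finset.sum_sub_distrib]
    refine Finset.sum_congr rfl fun r _ => ?_
    by_cases hr : (r, c) ∈ paramSet t m
    · simp only [paramMatrix_of_mem hr, T, δ, dif_pos hr, C_sub]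
      ring
    · simp [paramMatrix_of_notMem hr, T, δ, dif_neg hr]
  have hT0 : ∀ r, δ r ≠ 0 → T r ≠ 0 := fun r hr =>
    mul_ne_zero (mul_ne_zero (by simpa using hr) (X_one_pow_ne_zero _)) (hF.isLead hm r).ne_zero
  have hTd : ∀ r, δ r ≠ 0 →
      lexOrd.degree (T r) = mon (t - r) ((uDeg m r c).toNat + m r) := fun r hr => by
    have hl := (isLead_X_one_pow (k := k) (uDeg m r c).toNat).mul (hF.isLead hm r)
    simp only [T]
    rw [mul_assoc, MonomialOrder.degree_mul (by simpa using hr) hl.ne_zero,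
      MonomialOrder.degree_C, hl.1, zero_add, zero_add]
  obtain ⟨h0, s, hs, hd⟩ := exists_degree_sum_eq (Finset.univ.filter fun r => δ r ≠ 0)
    ⟨r, by simpa using hδ⟩ T (fun r hr => hT0 r (by simpa using hr)) (by
      intro i hi j hj hij
      rw [hTd i (by simpa using hi), hTd j (by simpa using hj)] at hij
      have := DFunLike.congr_fun hij 0
      simp only [mon_apply_zero] at this
      have hi := i.is_le
      have hj := j.is_le
      exact Fin.ext (by omega))
  have hs : δ s ≠ 0 := by simpa using hs
  rw [← hsum] at h0 hd
  rw [hTd s hs, lexOrd.degree_mul' h0, (isLead_X_one_pow _).1] at hd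
  have hD0 := right_ne_zero_of_mul h0
  have h1 : lexOrd.degree (F c.castSucc - G c.castSucc) 0 = t - s := by
    simpa using DFunLike.congr_fun hd 0
  have h2 : dExp m c + lexOrd.degree (F c.castSucc - G c.castSucc) 1 =
      (uDeg m s c).toNat + m s := by
    simpa using DFunLike.congr_fun hd 1
  have hmem : F c.castSucc - G c.castSucc ∈ Ideal.span (Set.range F) :=
    sub_mem (Ideal.subset_span ⟨_, rfl⟩) (hI ▸ Ideal.subset_span ⟨_, rfl⟩)
  have hle := hF.le_of_mem_leadIdeal hm (r := s)
    (e := lexOrd.degree (F c.castSucc - G c.castSucc) 1) (by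
      rw [← h1, ← eq_mon]
      exact Ideal.subset_span ⟨_, hmem, hD0, rfl⟩)
  -- The y-exponent of the leading monomial of F_c - G_c is u_{sc} + m_s - d_c < m_s, contrary to
  -- `hle`.
  have hu1 : 0 ≤ uDeg m s c := (hδmem s hs).2.1
  have hu2 : uDeg m s c < dExp m c := (hδmem s hs).2.2
  omega

lemma IsChain.param_eq (hm : Monotone m) (hF : IsChain p F) (hG : IsChain q G)
    (hI : Ideal.span (Set.range F) = Ideal.span (Set.range G)) : p = q := by
  have hFG : ∀ r, F r = G r := by
    intro r
    induction r using row_induction with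
    | last => rw [hF.last, hG.last]
    | step c ih =>
      refine (hF.rel c).eq_of_eq ?_ ih
      have := hG.rel c
      have hpq : ∀ r, paramMatrix t m p r c = paramMatrix t m q r c := fun r => by
        by_cases hr : (r, c) ∈ paramSet t m
        · rw [paramMatrix_of_mem hr, paramMatrix_of_mem hr, hF.column_eq hm hG hI ih r hr]
        · rw [paramMatrix_of_notMem hr, paramMatrix_of_notMem hr]
      simpa only [ColumnRel, hpq] using this
  funext ⟨⟨r, c⟩, h⟩
  exact hF.column_eq hm hG hI (fun r _ => hFG r) r h

end Injectivity

/-! ### Surjectivity of the parametrization -/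

section Surjectivity

variable {k : Type*} [Field k] {t : ℕ} {m : ℕ → ℕ} {I : Ideal (Poly k)}

/-- Homogeneous elements of `I` of small degree in `x` are combinations of the `F r` with
coefficients that are powers of `y` up to constants. -/
lemma exists_expansion (hle : ∀ (r : Fin (t + 1)) (e : ℕ),
      monomial (mon (t - r) e) (1 : k) ∈ leadIdeal I → m r ≤ e)
    {F : Fin (t + 1) → Poly k} {c : Fin (t + 1)}
    (hFI : ∀ r, c < r → F r ∈ I) (hlead : ∀ r, c < r → IsLead (F r) (t - r) (m r))
    (hhom : ∀ r, c < r → (F r).IsHomogeneous (genDeg m r)) {d : ℕ} {h : Poly k} (hI : h ∈ I)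
    (hh : h.IsHomogeneous d) (hx : h ∈ xLT k (t - c)) :
    ∃ q : Fin (t + 1) → k, ∑ r, q r •
      (if c < r ∧ genDeg m r ≤ d then X 1 ^ (d - genDeg m r) * F r else 0) = h := by
  rw [← Submodule.mem_span_range_iff_exists_fun]
  suffices H : ∀ n, n ≤ t - c → ∀ h ∈ I, h.IsHomogeneous d → h ∈ xLT k n →
      h ∈ Submodule.span k (Set.range fun r : Fin (t + 1) =>
        if c < r ∧ genDeg m r ≤ d then X 1 ^ (d - genDeg m r) * F r else 0) from
    H _ le_rfl h hI hh hx
  intro n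
  induction n with
  | zero =>
    intro _ h _ _ hx
    rcases mem_xLT_iff_degree.mp hx with rfl | hx
    · exact zero_mem _
    · exact absurd hx (Nat.not_lt_zero _)
  | succ n ih =>
    intro hn h hI hh hx
    by_cases ha : coeff (mon n (d - n)) h = 0
    · refine ih (by omega) h hI hh ?_
      have := sub_mem_xLT hh (isHomogeneous_zero _ _ d) hx (zero_mem _) (by rw [ha, coeff_zero])
      rwa [sub_zero] at this
    · have h0 : h ≠ 0 := by
        rintro rfl
        simp at ha
      have hsum := degree_of_isHomogeneous hh h0
      have h1 : lexOrd.degree h 0 < n + 1 := (mem_xLT_iff_degree.mp hx).resolve_left h0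
      have h2 : n ≤ lexOrd.degree h 0 := by
        simpa using fst_le_of_lex_le (lexOrd.le_degree (mem_support_iff.mpr ha))
      have hdeg : lexOrd.degree h = mon n (d - n) := exponent_ext (by simp; omega) (by simp; omega)
      -- The leading monomial of `h` has x-exponent n, and row t - n holds the generator that can
      -- cancel it; `hle` ensures that its y-exponent is small enough.
      let r : Fin (t + 1) := ⟨t - n, by omega⟩
      have hr : (r : ℕ) = t - n := rfl
      have hcr : c < r := by
        rw [Fin.lt_def, hr]; omega
      have htr : t - (r : ℕ) = n := by omega
      have hmr : m r ≤ d - n := hle r (d - n) (by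
        rw [htr, ← hdeg]
        exact Ideal.subset_span ⟨h, hI, h0, rfl⟩)
      have hg : genDeg m r = n + m r := by rw [genDeg, htr]
      have hv : IsLead (X 1 ^ (d - genDeg m r) * F r) n (d - n) := by
        have := (isLead_X_one_pow (k := k) (d - genDeg m r)).mul (hlead r hcr)
        rwa [htr, zero_add, show d - genDeg m r + m r = d - n by omega] at this
      have hvh : (X 1 ^ (d - genDeg m r) * F r).IsHomogeneous d := by
        have := (isHomogeneous_X_pow (R := k) (1 : Fin 2) (d - genDeg m r)).mul (hhom r hcr)
        rwa [show d - genDeg m r + genDeg m r = d by omega] at this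
      set v := X 1 ^ (d - genDeg m r) * F r with hv_def
      set a := coeff (mon n (d - n)) h with ha_def
      have hvI : a • v ∈ I := Submodule.smul_of_tower_mem I a (Ideal.mul_mem_left _ _ (hFI r hcr))
      have hav : (a • v).IsHomogeneous d := by
        rw [smul_eq_C_mul]; exact hvh.C_mul a
      have hmem := ih (by omega) (h - a • v) (sub_mem hI hvI) (hh.sub hav)
        (sub_mem_xLT hh hav hx (Submodule.smul_mem _ _ (hv.mem_xLT (Nat.lt_succ_self n)))
          (by rw [coeff_smul, hv.coeff, smul_eq_mul, mul_one]))
      have hvmem : v ∈ Submodule.span k (Set.range fun r : Fin (t + 1) =>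
          if c < r ∧ genDeg m r ≤ d then X 1 ^ (d - genDeg m r) * F r else 0) :=
        Submodule.subset_span ⟨r, if_pos ⟨hcr, by omega⟩⟩
      have := add_mem hmem (Submodule.smul_mem _ a hvmem)
      rwa [sub_add_cancel] at this

/-- One more row and column of a partial chain. -/
lemma exists_columnRel (hm : Monotone m)
    (hI : I.IsHomogeneous (homogeneousSubmodule (Fin 2) k))
    (hlt : ∀ r : Fin (t + 1), monomial (mon (t - r) (m r)) (1 : k) ∈ leadIdeal I)
    (hle : ∀ (r : Fin (t + 1)) (e : ℕ),
      monomial (mon (t - r) e) (1 : k) ∈ leadIdeal I → m r ≤ e)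
    {F : Fin (t + 1) → Poly k} {c : Fin t}
    (hFI : ∀ r, c.castSucc < r → F r ∈ I)
    (hlead : ∀ r, c.castSucc < r → IsLead (F r) (t - r) (m r))
    (hhom : ∀ r, c.castSucc < r → (F r).IsHomogeneous (genDeg m r)) :
    ∃ (q : Fin (t + 1) → k) (f : Poly k), f ∈ I ∧ X 1 ^ dExp m c * f =
      X 0 * F c.succ - ∑ r, paramMatrix t m (fun s => q s.1.1) r c * F r := by
  have hcs : c.castSucc < c.succ := Fin.castSucc_lt_succ
  have hmc : m c ≤ m (c + 1) := hm (Nat.le_succ c)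
  obtain ⟨g, hgI, hgh, hgl⟩ := exists_isHomogeneous_isLead hI (hlt c.castSucc)
  change g.IsHomogeneous (genDeg m c.castSucc) at hgh
  rw [Fin.val_castSucc] at hgl
  have h1l := isLead_X_zero.mul (hlead _ hcs)
  have h2l := (isLead_X_one_pow (k := k) (dExp m c)).mul hgl
  have h1h := (isHomogeneous_X k (0 : Fin 2)).mul (hhom _ hcs)
  rw [genDeg_succ hm] at h1h
  have h2h := (isHomogeneous_X_pow (R := k) (1 : Fin 2) (dExp m c)).mul hgh
  have hs : 1 + (t - (c.succ : Fin (t + 1))) = t - c := by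
    rw [Fin.val_succ]; omega
  have he : 0 + m (c.succ : Fin (t + 1)) = dExp m c + m c := by
    simp only [dExp, Fin.val_succ]; omega
  have hd : dExp m c + genDeg m c.castSucc - (t - c) = dExp m c + m c := by
    simp only [genDeg, Fin.val_castSucc]; omega
  rw [hs, he] at h1l
  rw [zero_add] at h2l
  obtain ⟨q, hq⟩ := exists_expansion (d := dExp m c + genDeg m c.castSucc) hle hFI hlead hhom
    (h := X 0 * F c.succ - X 1 ^ dExp m c * g)
    (sub_mem (Ideal.mul_mem_left _ _ (hFI _ hcs)) (Ideal.mul_mem_left _ _ hgI))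
    (h1h.sub h2h) (sub_mem_xLT h1h h2h (h1l.mem_xLT (Nat.lt_succ_self _))
      (h2l.mem_xLT (Nat.lt_succ_self _)) (by rw [Fin.val_castSucc, hd, h1l.coeff, h2l.coeff]))
  -- The terms of the expansion with y-exponent at least d_c, those with deg F_r ≤ deg F_c, are
  -- divided by y^{d_c} and absorbed into `g`. The others have 0 ≤ u_{rc} < d_c and become
  -- parameters.
  refine ⟨q, g + ∑ r, q r • (if c.castSucc < r ∧ genDeg m r ≤ genDeg m c.castSucc then
    X 1 ^ (genDeg m c.castSucc - genDeg m r) * F r else 0), ?_, ?_⟩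
  · refine add_mem hgI (Ideal.sum_mem _ fun r _ => Submodule.smul_of_tower_mem I _ ?_)
    split_ifs with h
    · exact Ideal.mul_mem_left _ _ (hFI r h.1)
    · exact zero_mem _
  · rw [mul_add, eq_sub_iff_add_eq, add_assoc, ← eq_sub_iff_add_eq', ← hq, Finset.mul_sum,
      ← Finset.sum_add_distrib]
    refine Finset.sum_congr rfl fun r _ => ?_
    by_cases hS : (r, c) ∈ paramSet t m
    · rw [paramMatrix_of_mem hS]
      obtain ⟨h1, h2, h3⟩ := (mem_paramSet_iff hm).mp hS
      rw [if_neg (by omega), if_pos ⟨h1, h3⟩, uDeg_eq hm, smul_zero, mul_zero, zero_add,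
        smul_eq_C_mul, ← Nat.cast_sub h3, Int.toNat_natCast, mul_assoc]
    · rw [paramMatrix_of_notMem hS, zero_mul, add_zero]
      rw [mem_paramSet_iff hm] at hS
      by_cases h : c.castSucc < r ∧ genDeg m r ≤ genDeg m c.castSucc
      · rw [if_pos h, if_pos ⟨h.1, by omega⟩, Nat.add_sub_assoc h.2, pow_add, smul_eq_C_mul,
          smul_eq_C_mul]
        ring
      · rw [if_neg h, if_neg (by omega), smul_zero, mul_zero]

/-- Induction on the number `j` of columns treated, counted from the right: rows and columns of
index at least t - j are final, and the remaining values of `F` and `p` are arbitrary. -/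
lemma exists_isChain_mem (hm : Monotone m)
    (hI : I.IsHomogeneous (homogeneousSubmodule (Fin 2) k))
    (hlt : ∀ r : Fin (t + 1), monomial (mon (t - r) (m r)) (1 : k) ∈ leadIdeal I)
    (hle : ∀ (r : Fin (t + 1)) (e : ℕ),
      monomial (mon (t - r) e) (1 : k) ∈ leadIdeal I → m r ≤ e) :
    ∃ (p : paramSet t m → k) (F : Fin (t + 1) → Poly k), IsChain p F ∧ ∀ r, F r ∈ I := by
  suffices H : ∀ j, j ≤ t → ∃ (p : paramSet t m → k) (F : Fin (t + 1) → Poly k),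
      F (Fin.last t) = X 1 ^ m t ∧ (∀ r : Fin (t + 1), t - j ≤ r → F r ∈ I) ∧
      ∀ c : Fin t, t - j ≤ c → ColumnRel p F c by
    obtain ⟨p, F, h1, h2, h3⟩ := H t le_rfl
    exact ⟨p, F, ⟨h1, fun c => h3 c (by omega)⟩, fun r => h2 r (by omega)⟩
  intro j
  induction j with
  | zero =>
    intro _
    obtain ⟨g, hgI, hgh, hgl⟩ := exists_isHomogeneous_isLead hI (hlt (Fin.last t))
    rw [Fin.val_last, Nat.sub_self, zero_add] at hgh
    rw [Fin.val_last, Nat.sub_self] at hgl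
    have hg : g = X 1 ^ m t := by
      have hX := isLead_X_one_pow (k := k) (m t)
      have := sub_mem_xLT (s := 0) hgh (isHomogeneous_X_pow (1 : Fin 2) (m t))
        (hgl.mem_xLT one_pos) (hX.mem_xLT one_pos) (by rw [Nat.sub_zero, hgl.coeff, hX.coeff])
      rcases mem_xLT_iff_degree.mp this with h | h
      · exact sub_eq_zero.mp h
      · exact absurd h (Nat.not_lt_zero _)
    refine ⟨0, fun _ => X 1 ^ m t, rfl, fun r _ => hg ▸ hgI, fun c hc => ?_⟩
    have := c.is_lt
    omega
  | succ j ih =>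
    intro hj
    obtain ⟨p, F, hlast, hFI, hrel⟩ := ih (by omega)
    have hlead : ∀ r : Fin (t + 1), t - j ≤ r → IsLead (F r) (t - r) (m r) := by
      intro r
      induction r using row_induction with
      | last => intro _; simpa [hlast] using isLead_X_one_pow (k := k) (m t)
      | step c ih =>
        intro hc
        refine (hrel c hc).isLead hm fun r hr => ih r hr (hc.trans (le_of_lt hr))
    have hhom : ∀ r : Fin (t + 1), t - j ≤ r → (F r).IsHomogeneous (genDeg m r) := by
      intro r
      induction r using row_induction with
      | last =>
        intro _
        simpa [hlast, genDeg] using isHomogeneous_X_pow (R := k) (1 : Fin 2) (m t)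
      | step c ih =>
        intro hc
        refine (hrel c hc).isHomogeneous hm fun r hr => ih r hr (hc.trans (le_of_lt hr))
    let c : Fin t := ⟨t - (j + 1), by omega⟩
    have hcv : (c : ℕ) = t - (j + 1) := rfl
    have hc : ∀ r : Fin (t + 1), c.castSucc < r → t - j ≤ r := fun r hr => by
      have : (c : ℕ) < r := hr
      omega
    obtain ⟨q, f, hfI, hf⟩ := exists_columnRel hm hI hlt hle (fun r hr => hFI r (hc r hr))
      (fun r hr => hlead r (hc r hr)) (fun r hr => hhom r (hc r hr))
    let F' : Fin (t + 1) → Poly k := Function.update F c.castSucc f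
    have hF' : ∀ r, c.castSucc < r → F' r = F r := fun r hr =>
      Function.update_of_ne hr.ne' _ _
    -- Only column `c` changes; the relations of later columns involve neither these parameters nor
    -- F_c.
    let p' : paramSet t m → k := fun s => if s.1.2 = c then q s.1.1 else p s
    refine ⟨p', F', ?_, fun r hr => ?_, fun c' hc' => ?_⟩
    · rw [hF' _ (Fin.castSucc_lt_last c), hlast]
    · by_cases hrc : r = c.castSucc
      · subst hrc
        simpa [F'] using hfI
      · rw [show F' r = F r from Function.update_of_ne hrc _ _]
        have : (r : ℕ) ≠ c := fun h => hrc (Fin.ext h)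
        exact hFI r (by omega)
    · by_cases hcc : c' = c
      · subst hcc
        have hp : ∀ r, paramMatrix t m p' r c = paramMatrix t m (fun s => q s.1.1) r c := by
          intro r
          by_cases hS : (r, c) ∈ paramSet t m
          · simp [paramMatrix_of_mem hS, p']
          · simp [paramMatrix_of_notMem hS]
        have hF0 : F' c.castSucc = f := Function.update_self _ _ _
        rw [ColumnRel, hF0, hf, hF' _ Fin.castSucc_lt_succ, sum_paramMatrix_congr hF']
        simp only [hp]
      · have hlt' : c.castSucc < c'.castSucc := by
          have : (c' : ℕ) ≠ c := fun h => hcc (Fin.ext h)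
          rw [Fin.lt_def, Fin.val_castSucc, Fin.val_castSucc]
          omega
        have hp : ∀ r, paramMatrix t m p' r c' = paramMatrix t m p r c' := by
          intro r
          by_cases hS : (r, c') ∈ paramSet t m
          · simp [paramMatrix_of_mem hS, p', hcc]
          · simp [paramMatrix_of_notMem hS]
        rw [ColumnRel, hF' _ hlt', hrel c' (by
          have : (c : ℕ) < c' := hlt'
          omega), hF' _ (hlt'.trans Fin.castSucc_lt_succ),
          sum_paramMatrix_congr fun r hr => hF' r (hlt'.trans hr)]
        simp only [hp]

end Surjectivity

/-! ### The parametrization of the cell -/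

section Bijection

variable {k : Type*} [Field k] {E : Ideal (Poly k)}

lemma leadIdeal_cellMap (hE : IsMonomialIdeal E) (hfin : Module.Finite k (Poly k ⧸ E))
    (p : paramSet (tOf E) (mOf E) → k) : leadIdeal (cellMap E p) = E := by
  have hm := mOf_monotone hE hfin
  have hF := isChain_signedMinor hm (mOf_zero hE hfin) p
  rw [cellMap, ← span_signedMinor, hF.leadIdeal_span hm, ← hE.eq_span hfin]

lemma cellMap_mem_cell (hE : IsMonomialIdeal E) (hfin : Module.Finite k (Poly k ⧸ E))
    (p : paramSet (tOf E) (mOf E) → k) : cellMap E p ∈ cell E := by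
  have hm := mOf_monotone hE hfin
  have hF := isChain_signedMinor hm (mOf_zero hE hfin) p
  refine ⟨?_, leadIdeal_cellMap hE hfin p⟩
  rw [cellMap, ← span_signedMinor]
  exact hF.span_isHomogeneous hm

theorem cellMap_bijOn (hE : IsMonomialIdeal E) (hfin : Module.Finite k (Poly k ⧸ E)) :
    Set.BijOn (cellMap E) Set.univ (cell E) := by
  have hm := mOf_monotone hE hfin
  have hm0 := mOf_zero hE hfin
  refine ⟨fun p _ => cellMap_mem_cell hE hfin p, fun p _ q _ hpq => ?_, ?_⟩
  · simp only [cellMap, ← span_signedMinor] at hpq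
    exact (isChain_signedMinor hm hm0 p).param_eq hm (isChain_signedMinor hm hm0 q) hpq
  · rintro I ⟨hI, hlead⟩
    obtain ⟨p, F, hF, hFI⟩ := exists_isChain_mem (t := tOf E) hm hI
      (fun r => by rw [hlead]; exact monomial_mon_mOf_mem hE hfin r)
      (fun r e h => mOf_le_of_mem (by rwa [hlead] at h))
    refine ⟨p, trivial, eq_of_le_of_leadIdeal_le ?_ ?_⟩
    · rw [cellMap, ← hF.span_eq hm hm0, Ideal.span_le]
      rintro _ ⟨r, rfl⟩
      exact hFI r
    · rw [hlead, leadIdeal_cellMap hE hfin]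

end Bijection

/-! ### Graded Betti numbers -/

section Betti

variable {k : Type*} [Field k]

lemma mem_degreePart_natCast {n : ℕ} {f : Poly k} :
    f ∈ degreePart k n ↔ f.IsHomogeneous n := by
  rw [degreePart, mem_restrictSupport_iff, isHomogeneous_iff]
  refine forall_congr' fun e => ?_
  rw [Finset.mem_coe, mem_support_iff, ← exponent_degree]
  change (_ → (e.degree : ℤ) = n) ↔ _
  rw [Nat.cast_inj]

lemma eq_zero_of_mem_degreePart {j : ℤ} (hj : j < 0) {f : Poly k} (hf : f ∈ degreePart k j) :
    f = 0 := by
  rw [degreePart, mem_restrictSupport_iff] at hf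
  rw [← support_eq_empty, Finset.eq_empty_iff_forall_notMem]
  intro e he
  have h : ((e.degree : ℕ) : ℤ) = j := hf he
  omega

lemma mem_idealPart {I : Ideal (Poly k)} {j : ℤ} {f : Poly k} :
    f ∈ idealPart I j ↔ f ∈ I ∧ f ∈ degreePart k j := Iff.rfl

variable (k) in
/-- The ideal `(x, y)`. -/
abbrev irrelevant : Ideal (Poly k) := Ideal.span {X 0, X 1}

lemma mem_irrelevant {f : Poly k} : f ∈ irrelevant k ↔ constantCoeff f = 0 := by
  constructor
  · intro h
    have hle : irrelevant k ≤ RingHom.ker (constantCoeff : Poly k →+* k) := by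
      rw [Ideal.span_le]
      rintro _ (rfl | rfl) <;> simp
    exact hle h
  · intro h
    have : ({X 0, X 1} : Set (Poly k)) = X '' Set.univ := by
      ext g
      simp [Fin.exists_fin_two, eq_comm]
    rw [irrelevant, this, mem_ideal_span_X_image]
    intro e he
    by_contra! hne
    have he0 : e = 0 := by
      ext i
      simpa using hne i trivial
    rw [mem_support_iff, he0] at he
    exact he h

lemma irrelevant_isHomogeneous :
    (irrelevant k).IsHomogeneous (homogeneousSubmodule (Fin 2) k) := by
  refine Ideal.homogeneous_span _ _ ?_
  rintro _ (rfl | rfl) <;> exact ⟨1, isHomogeneous_X _ _⟩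

/-- Used to pass, modulo (x, y) I, from sums over all rows to sums over the rows of the reduced
block. -/
lemma sum_sub_sum_mem {R ι κ : Type*} [CommRing R] [Fintype ι] [Fintype κ] {e : κ → ι}
    (he : Function.Injective e) (J : Ideal R) (f : ι → R) (h : ∀ i ∉ Set.range e, f i ∈ J) :
    ∑ i, f i - ∑ s, f (e s) ∈ J := by
  classical
  rw [Fintype.sum_of_injective e he (fun s => f (e s))
    (fun i => if i ∈ Set.range e then f i else 0) (fun i hi => if_neg hi)
    (fun s => (if_pos ⟨s, rfl⟩).symm), ← Finset.sum_sub_distrib]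
  refine Ideal.sum_mem _ fun i _ => ?_
  split_ifs with hi
  · rw [sub_self]; exact zero_mem _
  · rw [sub_zero]; exact h i hi

variable {t : ℕ} {m : ℕ → ℕ}

lemma mem_rowsOf {j : ℤ} {r : Fin (t + 1)} : r ∈ rowsOf t m j ↔ (genDeg m r : ℤ) = j := by
  simp [rowsOf, rowDeg_eq]

lemma mem_colsOf (hm : Monotone m) {j : ℤ} {c : Fin t} :
    c ∈ colsOf t m j ↔ ((dExp m c + genDeg m c.castSucc : ℕ) : ℤ) = j := by
  have := genDeg_succ hm c
  simp only [colsOf, Finset.mem_filter, Finset.mem_univ, true_and, colDeg, rowDeg_eq]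
  omega

/-- The rows of the reduced block in degree `j`. -/
abbrev StarRow (t : ℕ) (m : ℕ → ℕ) (j : ℤ) : Type :=
  {r : rowsOf t m j // ∀ c ∈ colsOf t m j, c.castSucc ≠ r.1}

/-- The columns of the reduced block in degree `j`. -/
abbrev StarCol (t : ℕ) (m : ℕ → ℕ) (j : ℤ) : Type :=
  {c : colsOf t m j // c.1.castSucc ∉ rowsOf t m j}

/-- The row index of a row of the reduced block. -/
def StarRow.index {j : ℤ} (r : StarRow t m j) : Fin (t + 1) := r.1.1

/-- The column index of a column of the reduced block. -/
def StarCol.index {j : ℤ} (c : StarCol t m j) : Fin t := c.1.1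

lemma StarRow.index_injective {j : ℤ} :
    Function.Injective (StarRow.index : StarRow t m j → Fin (t + 1)) :=
  Subtype.val_injective.comp Subtype.val_injective

lemma StarCol.index_injective {j : ℤ} :
    Function.Injective (StarCol.index : StarCol t m j → Fin t) :=
  Subtype.val_injective.comp Subtype.val_injective

lemma StarRow.genDeg_index {j : ℤ} (r : StarRow t m j) : (genDeg m r.index : ℤ) = j :=
  mem_rowsOf.mp r.1.2

lemma blockMatrixStar_apply {p : paramSet t m → k} {j : ℤ} (r : StarRow t m j)
    (c : StarCol t m j) :
    blockMatrixStar t m p j r c = constantCoeff (canonMatrix t m p r.index c.index) := rfl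

/-- A row of degree `j` is a row of the reduced block, or carries a unit entry. -/
lemma exists_of_notMem_range_index (hm : Monotone m) {j : ℤ} {r : Fin (t + 1)}
    (hr : r ∉ Set.range (StarRow.index : StarRow t m j → Fin (t + 1)))
    (hj : (genDeg m r : ℤ) = j) : ∃ c : Fin t, r = c.castSucc ∧ dExp m c = 0 := by
  by_contra! h
  refine hr ⟨⟨⟨r, mem_rowsOf.mpr hj⟩, fun c hc hcr => h c hcr.symm ?_⟩, rfl⟩
  rw [mem_colsOf hm] at hc
  change c.castSucc = r at hcr
  subst hcr
  omega

lemma notMem_paramSet_of_dExp_eq_zero (hm : Monotone m) {c : Fin t} (hc : dExp m c = 0)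
    (r : Fin (t + 1)) : (r, c) ∉ paramSet t m := by
  rw [mem_paramSet_iff hm]
  omega

lemma constantCoeff_baseMatrix {r : Fin (t + 1)} {c : Fin t} (h : r ≠ c.castSucc) :
    constantCoeff (baseMatrix k t m r c) = 0 := by
  simp only [baseMatrix, Matrix.of_apply, if_neg h]
  split_ifs <;> simp

/-- The entries with nonzero constant term have degree zero. -/
lemma genDeg_eq_of_constantCoeff_ne_zero (hm : Monotone m) {p : paramSet t m → k}
    {r : Fin (t + 1)} {c : Fin t} (h : constantCoeff (canonMatrix t m p r c) ≠ 0) :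
    genDeg m r = dExp m c + genDeg m c.castSucc := by
  by_contra hne
  apply h
  rw [canonMatrix, Matrix.add_apply, map_add]
  have hN : constantCoeff (paramMatrix t m p r c) = 0 := by
    by_cases hS : (r, c) ∈ paramSet t m
    · have h3 := ((mem_paramSet_iff hm).mp hS).2.2
      have : (uDeg m r c).toNat ≠ 0 := by
        rw [uDeg_eq hm]; omega
      simp [paramMatrix_of_mem hS, this]
    · simp [paramMatrix_of_notMem hS]
  have hB : constantCoeff (baseMatrix k t m r c) = 0 := by
    by_cases h1 : r = c.castSucc
    · subst h1
      have : dExp m c ≠ 0 := by omega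
      simp [baseMatrix, this]
    · exact constantCoeff_baseMatrix h1
  rw [hN, hB, add_zero]

/-- Outside the reduced block, the columns vanish on the rows of the reduced block. -/
lemma constantCoeff_eq_zero_of_notMem_range (hm : Monotone m) {p : paramSet t m → k} {j : ℤ}
    (r : StarRow t m j) {c : Fin t}
    (hc : c ∉ Set.range (StarCol.index : StarCol t m j → Fin t)) :
    constantCoeff (canonMatrix t m p r.index c) = 0 := by
  by_contra hne
  have hdeg := genDeg_eq_of_constantCoeff_ne_zero hm hne
  have hcj : c ∈ colsOf t m j := by
    rw [mem_colsOf hm, ← hdeg, r.genDeg_index]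
  have hcr : c.castSucc ∈ rowsOf t m j := by
    by_contra h
    exact hc ⟨⟨⟨c, hcj⟩, h⟩, rfl⟩
  -- Row c and column c both have degree `j`, so the diagonal entry has degree zero. Then no
  -- parameter fits in column c, and its only unit entry lies in a deleted row.
  have hd : dExp m c = 0 := by
    rw [mem_rowsOf] at hcr
    rw [mem_colsOf hm] at hcj
    omega
  have hrc : r.index ≠ c.castSucc := (r.2 c hcj).symm
  apply hne
  rw [canonMatrix, Matrix.add_apply,
    paramMatrix_of_notMem (notMem_paramSet_of_dExp_eq_zero hm hd _), add_zero]
  exact constantCoeff_baseMatrix hrc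

variable {p : paramSet t m → k} {F : Fin (t + 1) → Poly k}

/-- A column with d_c = 0 carries no parameters, so its relation is F_c = x F_{c+1}. -/
lemma IsChain.mem_irrelevant_mul (hm : Monotone m) (hF : IsChain p F) {c : Fin t}
    (hc : dExp m c = 0) : F c.castSucc ∈ irrelevant k * Ideal.span (Set.range F) := by
  have h := hF.rel c
  rw [ColumnRel, hc, pow_zero, one_mul, Finset.sum_eq_zero fun r _ => by
    rw [paramMatrix_of_notMem (notMem_paramSet_of_dExp_eq_zero hm hc r), zero_mul], sub_zero] at h
  rw [h]
  exact Ideal.mul_mem_mul (mem_irrelevant.mpr (by simp)) (Ideal.subset_span ⟨_, rfl⟩)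

lemma sum_sub_constantCoeff_mem (g : Fin (t + 1) → Poly k) :
    ∑ r, g r * F r - ∑ r, C (constantCoeff (g r)) * F r ∈
      irrelevant k * Ideal.span (Set.range F) := by
  rw [← Finset.sum_sub_distrib]
  refine Ideal.sum_mem _ fun r _ => ?_
  rw [← sub_mul]
  exact Ideal.mul_mem_mul (mem_irrelevant.mpr (by simp)) (Ideal.subset_span ⟨r, rfl⟩)

/-- A combination of the generators of degree `j` lies in `(x, y) I` if and only if its
coefficients lie in the column space of the reduced block. -/
lemma IsChain.sum_mem_irrelevant_mul_iff (hm : Monotone m) (hF : IsChain p F) {j : ℤ}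
    (v : StarRow t m j → k) :
    ∑ r, C (v r) * F r.index ∈ irrelevant k * Ideal.span (Set.range F) ↔
      v ∈ LinearMap.range (blockMatrixStar t m p j).mulVecLin := by
  constructor
  · intro h
    rw [← smul_eq_mul (a := irrelevant k), Ideal.span,
      Submodule.mem_ideal_smul_span_iff_exists_sum] at h
    obtain ⟨g, hg, hsum⟩ := h
    rw [Finsupp.sum_fintype _ _ (by simp)] at hsum
    let w : Fin (t + 1) → Poly k := Function.extend StarRow.index (fun r => C (v r)) 0
    have hw : ∀ r : StarRow t m j, w r.index = C (v r) := fun r =>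
      StarRow.index_injective.extend_apply _ _ r
    have hwsum : ∑ r, C (v r) * F r.index = ∑ r, w r * F r :=
      Fintype.sum_of_injective _ StarRow.index_injective _ _
        (fun r hr => by simp [w, Function.extend_apply' _ _ r hr]) (fun r => by rw [hw])
    -- The vector `w` is `v` extended by zero and `g` has entries in (x, y). Writing this syzygy
    -- through the columns and taking constant terms eliminates `g` and expresses `v` through the
    -- columns of the block.
    have hsyz : ∑ r, (w - g) r * F r = 0 := by
      simp only [Pi.sub_apply, sub_mul, Finset.sum_sub_distrib]
      rw [← hwsum, ← hsum, sub_eq_zero]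
      rfl
    obtain ⟨a, ha⟩ := (Submodule.mem_span_range_iff_exists_fun _).mp (hF.mem_colSpan hm hsyz)
    refine ⟨fun c : StarCol t m j => constantCoeff (a c.index), ?_⟩
    funext (r : StarRow t m j)
    have h1 := congrArg constantCoeff (congrFun ha r.index)
    simp only [Finset.sum_apply, Pi.smul_apply, smul_eq_mul, map_sum, map_mul, Pi.sub_apply,
      map_sub, hw, constantCoeff_C, mem_irrelevant.mp (hg _), sub_zero] at h1
    rw [← h1, Matrix.mulVecLin_apply, Matrix.mulVec, dotProduct]
    refine Fintype.sum_of_injective _ StarCol.index_injective _ _ (fun c hc => ?_) (fun c => ?_)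
    · rw [constantCoeff_eq_zero_of_notMem_range hm r hc, mul_zero]
    · rw [blockMatrixStar_apply, mul_comm]
  · rintro ⟨a, rfl⟩
    have hcol : ∀ c : StarCol t m j, ∑ r : StarRow t m j,
        C (blockMatrixStar t m p j r c) * F r.index ∈
          irrelevant k * Ideal.span (Set.range F) := by
      intro c
      have h1 := sum_sub_constantCoeff_mem (F := F) fun r => canonMatrix t m p r c.index
      have h2 := sum_sub_sum_mem (StarRow.index_injective (t := t) (m := m) (j := j))
        (irrelevant k * Ideal.span (Set.range F))
        (fun r => C (constantCoeff (canonMatrix t m p r c.index)) * F r) (fun r hr => by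
          by_cases h0 : constantCoeff (canonMatrix t m p r c.index) = 0
          · rw [h0, C_0, zero_mul]; exact zero_mem _
          · have hdeg := genDeg_eq_of_constantCoeff_ne_zero hm h0
            have hcj := (mem_colsOf hm).mp c.1.2
            obtain ⟨c', rfl, hc'⟩ := exists_of_notMem_range_index hm hr
              (by rw [hdeg]; exact hcj)
            exact Ideal.mul_mem_left _ _ (hF.mem_irrelevant_mul hm hc'))
      rw [columnRel_iff.mp (hF.rel c.index), zero_sub, neg_mem_iff] at h1
      have h3 := sub_mem h1 h2
      rw [sub_sub_cancel] at h3
      exact h3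
    have hsum : ∑ r : StarRow t m j,
          C ((blockMatrixStar t m p j).mulVecLin a r) * F r.index =
        ∑ c, C (a c) * ∑ r : StarRow t m j, C (blockMatrixStar t m p j r c) * F r.index := by
      simp only [Matrix.mulVecLin_apply, Matrix.mulVec, dotProduct, map_sum, Finset.sum_mul,
        Finset.mul_sum, C_mul]
      rw [Finset.sum_comm]
      refine Finset.sum_congr rfl fun c _ => Finset.sum_congr rfl fun r _ => ?_
      ring
    rw [hsum]
    exact Ideal.sum_mem _ fun c _ => Ideal.mul_mem_left _ _ (hcol c)

/-- The generators belonging to the rows of the reduced block span `I` in degree `j` modulo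
`(x, y) I`. -/
lemma IsChain.exists_sub_mem (hm : Monotone m) (hF : IsChain p F) {j : ℤ} {h : Poly k}
    (hh : h ∈ idealPart (Ideal.span (Set.range F)) j) : ∃ v : StarRow t m j → k,
      h - ∑ r, C (v r) * F r.index ∈ irrelevant k * Ideal.span (Set.range F) := by
  obtain ⟨hI, hd⟩ := mem_idealPart.mp hh
  rcases lt_or_ge j 0 with hj | hj
  · refine ⟨0, ?_⟩
    simp [eq_zero_of_mem_degreePart hj hd]
  obtain ⟨n, rfl⟩ := Int.eq_ofNat_of_zero_le hj
  rw [mem_degreePart_natCast] at hd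
  obtain ⟨g, rfl⟩ := Ideal.mem_span_range_iff_exists_fun.mp hI
  refine ⟨fun r => constantCoeff (g r.index), ?_⟩
  -- Replacing the coefficients by their constant terms changes the sum by an element of (x, y) I;
  -- the degree-`n` component then retains only the generators of degree `n`.
  have h1 := homogeneousComponent_mem_of_mem
    (irrelevant_isHomogeneous.mul (hF.span_isHomogeneous hm)) (sum_sub_constantCoeff_mem g) n
  rw [map_sub, homogeneousComponent_eq_self hd, map_sum] at h1
  have hcomp : ∀ r, homogeneousComponent n (C (constantCoeff (g r)) * F r) =
      if genDeg m r = n then C (constantCoeff (g r)) * F r else 0 := fun r => by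
    rw [homogeneousComponent_of_mem ((hF.isHomogeneous hm r).C_mul _)]
    simp only [eq_comm]
  simp only [hcomp] at h1
  have h2 := sum_sub_sum_mem (StarRow.index_injective (t := t) (m := m) (j := n))
    (irrelevant k * Ideal.span (Set.range F))
    (fun r => if genDeg m r = n then C (constantCoeff (g r)) * F r else 0) (fun r hr => by
      split_ifs with hn
      · obtain ⟨c, rfl, hc⟩ := exists_of_notMem_range_index hm hr (by rw [hn])
        exact Ideal.mul_mem_left _ _ (hF.mem_irrelevant_mul hm hc)
      · exact zero_mem _)
  have h3 : ∀ r : StarRow t m n, genDeg m r.index = n := fun r => by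
    exact_mod_cast r.genDeg_index
  simp only [h3, if_true] at h2
  have := add_mem h1 h2
  rwa [sub_add_sub_cancel] at this

theorem IsChain.beta0_add_rank (hm : Monotone m) (hF : IsChain p F) (j : ℤ) :
    beta0 (Ideal.span (Set.range F)) j + (blockMatrixStar t m p j).rank =
      Fintype.card (StarRow t m j) := by
  set I := Ideal.span (Set.range F) with hI
  have hmem : ∀ v : StarRow t m j → k,
      Fintype.linearCombination k (fun r : StarRow t m j => F r.index) v ∈ idealPart I j := by
    intro v
    rw [Fintype.linearCombination_apply]
    refine Submodule.sum_mem _ fun r _ => Submodule.smul_mem _ _ ?_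
    refine ⟨Ideal.subset_span ⟨_, rfl⟩, ?_⟩
    have := (mem_degreePart_natCast (k := k)).mpr (hF.isHomogeneous hm r.index)
    rwa [r.genDeg_index] at this
  let Φ := LinearMap.codRestrict (idealPart I j) _ hmem
  let Q := (idealPart (irrelevant k * I) j).submoduleOf (idealPart I j)
  have hΦ : ∀ v, (Φ v : Poly k) = ∑ r, C (v r) * F r.index := fun v => by
    simp [Φ, Fintype.linearCombination_apply, smul_eq_C_mul]
  have hQ : ∀ x : idealPart I j, x ∈ Q ↔ (x : Poly k) ∈ irrelevant k * I := fun x =>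
    ⟨fun h => h.1, fun h => ⟨h, x.2.2⟩⟩
  -- Rank–nullity for the surjection from coefficient vectors onto (I/(x,y)I)_j, whose kernel is the
  -- column space of the block.
  have hker : LinearMap.ker (Q.mkQ ∘ₗ Φ) =
      LinearMap.range (blockMatrixStar t m p j).mulVecLin := by
    ext v
    rw [LinearMap.mem_ker, LinearMap.comp_apply, Submodule.mkQ_apply,
      Submodule.Quotient.mk_eq_zero, hQ, hΦ, hF.sum_mem_irrelevant_mul_iff hm]
  have hrange : LinearMap.range (Q.mkQ ∘ₗ Φ) = ⊤ := by
    rw [LinearMap.range_eq_top]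
    intro x
    obtain ⟨x, rfl⟩ := Q.mkQ_surjective x
    obtain ⟨v, hv⟩ := hF.exists_sub_mem hm x.2
    refine ⟨v, ?_⟩
    rw [LinearMap.comp_apply, ← sub_eq_zero, ← map_sub, Submodule.mkQ_apply,
      Submodule.Quotient.mk_eq_zero, hQ, ← neg_mem_iff]
    simpa [hΦ] using hv
  have h := LinearMap.finrank_range_add_finrank_ker (Q.mkQ ∘ₗ Φ)
  rw [hker, hrange, finrank_top, Module.finrank_fintype_fun_eq_card] at h
  exact h

lemma isChain_monomial (hm : Monotone m) :
    IsChain (k := k) (0 : paramSet t m → k)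
      fun r : Fin (t + 1) => monomial (mon (t - r) (m r)) (1 : k) := by
  refine ⟨by simp [monomial_mon], fun c => ?_⟩
  have hN : ∀ r, paramMatrix t m (0 : paramSet t m → k) r c = 0 := fun r => by
    simp [paramMatrix]
  have hmc : m c ≤ m (c + 1) := hm (Nat.le_succ c)
  have h1 : t - (c : ℕ) = t - (c + 1) + 1 := by omega
  have h2 : dExp m c + m c = m (c + 1) := by
    simp only [dExp]; omega
  simp only [ColumnRel, hN, zero_mul, Finset.sum_const_zero, sub_zero, monomial_mon,
    Fin.val_castSucc, Fin.val_succ]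
  rw [← h2, h1]
  ring

/-- The only unit entries at p = 0 are the diagonal ones, whose rows have been deleted. -/
lemma blockMatrixStar_zero (t : ℕ) (m : ℕ → ℕ) (j : ℤ) :
    blockMatrixStar t m (0 : paramSet t m → k) j = 0 := by
  ext (r : StarRow t m j) (c : StarCol t m j)
  have hrc : r.index ≠ c.index.castSucc := (r.2 _ c.1.2).symm
  have hN : paramMatrix t m (0 : paramSet t m → k) r.index c.index = 0 := by
    simp [paramMatrix]
  rw [blockMatrixStar_apply, canonMatrix, Matrix.add_apply, hN, add_zero]
  exact constantCoeff_baseMatrix hrc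

theorem beta0_cellMap_add_rank {E : Ideal (Poly k)} (hE : IsMonomialIdeal E)
    (hfin : Module.Finite k (Poly k ⧸ E)) (p : paramSet (tOf E) (mOf E) → k) (j : ℤ) :
    beta0 (cellMap E p) j + (blockMatrixStar (tOf E) (mOf E) p j).rank = beta0 E j := by
  have hm := mOf_monotone hE hfin
  have h0 := (isChain_monomial (k := k) (t := tOf E) hm).beta0_add_rank hm j
  rw [blockMatrixStar_zero, Matrix.rank_zero, add_zero, ← hE.eq_span hfin] at h0
  rw [h0, cellMap, ← span_signedMinor]
  exact (isChain_signedMinor hm (mOf_zero hE hfin) p).beta0_add_rank hm j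

end Betti

end HilbertBurch

end

theorem mainTheorem4 {k : Type*} [Field k] (E : Ideal (HilbertBurch.Poly k))
    (hE : HilbertBurch.IsMonomialIdeal E)
    (hfin : Module.Finite k (HilbertBurch.Poly k ⧸ E)) :
    Set.BijOn (HilbertBurch.cellMap E) Set.univ (HilbertBurch.cell E) ∧
    ∀ j u : ℤ, HilbertBurch.cellMap E ⁻¹' HilbertBurch.stratum E j u =
      {p | ((HilbertBurch.blockMatrixStar (HilbertBurch.tOf E) (HilbertBurch.mOf E) p j).rank : ℤ) ≤
        (HilbertBurch.beta0 E j : ℤ) - u} := by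
  refine ⟨HilbertBurch.cellMap_bijOn hE hfin, fun j u => ?_⟩
  ext p
  have h := HilbertBurch.beta0_cellMap_add_rank hE hfin p j
  rw [Set.mem_preimage, HilbertBurch.stratum, Set.mem_ofPred_eq, Set.mem_ofPred_eq]
  rw [and_iff_right (HilbertBurch.cellMap_mem_cell hE hfin p)]
  omega
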